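/- Let $N\ge 1$ and let $T_1,\dots,T_m$ be non-singular linear maps $\mathbb R^N\to\mathbb R^N$ with operator norms $\|T_i\|<1$ for all $i$. Write $I_k$ for the set of words of length $k$ over $\{1,\dots,m\}$, $I=\bigcup_{k\ge 0}I_k$, and $I_\infty=\{1,\dots,m\}^{\mathbb N}$ for the code space of infinite words with the product topology. For $\mathbf i=(i_1,\dots,i_k)\in I$ put $T_{\mathbf i}=T_{i_1}\cdots T_{i_k}$ (the identity for the empty word), and let $C_{\mathbf i}\subset I_\infty$ be the cylinder of all infinite words beginning with $\mathbf i$. For a linear map $T$ with singular values $\alpha_1\ge\dots\ge\alpha_N$, let $\phi^0(T)=1$, let $\phi^s(T)=\alpha_1\cdots\alpha_{j-1}\alpha_j^{\,s-j+1}$ for $0<s\le N$, where $j$ is the integer with $j-1<s\le j$, and let $\phi^s(T)=(\alpha_1\cdots\alpha_N)^{s/N}$ for $s>N$. Let $(\omega_{\mathbf i})_{\mathbf i\in I}$ be independent identically distributed random vectors taking values in a bounded set $D\subset\mathbb R^N$, whose common law is absolutely continuous with respect to Lebesgue measure. For $\mathbf i=(i_1,i_2,\dots)\in I_\infty$ let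 $$\Pi^\omega(\mathbf i)=\omega_{i_1}+T_{i_1}\omega_{i_1,i_2}+T_{i_1}T_{i_2}\omega_{i_1,i_2,i_3}+\cdots .$$ Let $\mu$ be a non-zero finite Borel measure on $I_\infty$ and let $\mu^\omega=\mu\circ(\Pi^\omega)^{-1}$ be its image under $\Pi^\omega$. For a non-zero finite Borel measure $\tau$ of bounded support on $\mathbb R^N$ and $q>1$, the lower generalised $q$-dimension of $\tau$ is $$\underline D_q(\tau)=\liminf_{r\to0^+}\frac{\log\sum_{C}\tau(C)^q}{(q-1)\log r},$$ where the sum is over the cubes $C=\prod_{l=1}^N[j_lr,(j_l+1)r)$ with $j_1,\dots,j_N\in\mathbb Z$. Then, for every $q>1$, almost surely $$\underline D_q(\mu^\omega)=\min\{d_q^-,N\},\qquad\text{where}\qquad d_q^-=\sup\Big\{s\ge0:\ \sum_{k=0}^\infty\sum_{\mathbf i\in I_k}\phi^s(T_{\mathbf i})^{1-q}\mu(C_{\mathbf i})^q<\infty\Big\}$$ and the supremum of the empty set is $0$. -/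

import Mathlib

open MeasureTheory ProbabilityTheory Filter Topology
open scoped ENNReal NNReal

noncomputable section

namespace AlmostSelfAffine

/-- `ℝ^N` with its Euclidean norm. -/
abbrev Esp (N : ℕ) : Type := EuclideanSpace ℝ (Fin N)

/-- The code space of infinite words over `m` letters, with the product topology (the topology of
the metric `2 ^ (-|i ∧ j|)`) and the product σ-algebra, which is its Borel σ-algebra. -/
abbrev CodeSpace (m : ℕ) : Type := ℕ → Fin m

/-- The curtailment `i|ₖ` of an infinite word after `k` terms. -/
def curtail {m : ℕ} (i : CodeSpace m) (k : ℕ) : List (Fin m) :=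
  List.ofFn fun j : Fin k => i j

/-- The cylinder of all infinite words that extend the finite word `w`. -/
def wordCylinder {m : ℕ} (w : List (Fin m)) : Set (CodeSpace m) :=
  {i | curtail i w.length = w}

/-- `T_w = T_{w₁} T_{w₂} ⋯ T_{w_k}`, the identity for the empty word. -/
def wordMap {m N : ℕ} (T : Fin m → Esp N →L[ℝ] Esp N) (w : List (Fin m)) :
    Esp N →L[ℝ] Esp N :=
  (w.map T).prod

/-- The singular value function `φ^s(T)`, `s ≥ 0`. Write `α₁ ≥ … ≥ α_N` for the singular values of
`T`; in Mathlib they are indexed from `0`. For `0 < s ≤ N` and the integer `j` with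
`j - 1 < s ≤ j` the value is `α₁ ⋯ α_{j-1} α_j ^ (s - (j - 1))`. At `s = 0` the truncated
subtraction `⌈0⌉₊ - 1 = 0` gives the exponent `0`, so that `φ^0(T) = 1`. For `s > N` the value is
`(α₁ ⋯ α_N) ^ (s / N)`. -/
def singularValueFunction {N : ℕ} (s : ℝ≥0) (T : Esp N →L[ℝ] Esp N) : ℝ :=
  if (s : ℝ) ≤ N then
    (∏ i ∈ Finset.range (⌈s⌉₊ - 1), T.toLinearMap.singularValues i) *
      T.toLinearMap.singularValues (⌈s⌉₊ - 1) ^ ((s : ℝ) - ((⌈s⌉₊ - 1 : ℕ) : ℝ))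
  else
    (∏ i ∈ Finset.range N, T.toLinearMap.singularValues i) ^ ((s : ℝ) / N)

/-- The series `∑_k ∑_{|i| = k} φ^s(T_i)^(1-q) μ(C_i)^q`. -/
def momentSeries {m N : ℕ} (T : Fin m → Esp N →L[ℝ] Esp N) (μ : Measure (CodeSpace m)) (q : ℝ)
    (s : ℝ≥0) : ℝ≥0∞ :=
  ∑' k : ℕ, ∑ i : Fin k → Fin m,
    ENNReal.ofReal (singularValueFunction s (wordMap T (List.ofFn i))) ^ (1 - q) *
      μ (wordCylinder (List.ofFn i)) ^ q

/-- `d_q^-(T₁, …, T_m; μ)`: the supremum of the `s ≥ 0` for which the series converges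
(`0` if there is no such `s`). -/
def dqLower {m N : ℕ} (T : Fin m → Esp N →L[ℝ] Esp N) (μ : Measure (CodeSpace m)) (q : ℝ) :
    ℝ≥0∞ :=
  ⨆ (s : ℝ≥0) (_ : momentSeries T μ q s < ∞), (s : ℝ≥0∞)

/-- The projection `Π^ω(i) = ω_{i₁} + T_{i₁} ω_{i₁,i₂} + T_{i₁} T_{i₂} ω_{i₁,i₂,i₃} + ⋯`
for a family `ω` of displacements indexed by the finite words. -/
def proj {m N : ℕ} (T : Fin m → Esp N →L[ℝ] Esp N) (ω : List (Fin m) → Esp N)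
    (i : CodeSpace m) : Esp N :=
  ∑' k : ℕ, wordMap T (curtail i k) (ω (curtail i (k + 1)))

/-- The image `μ^ω` of `μ` under `Π^ω`. -/
def projMeasure {m N : ℕ} (T : Fin m → Esp N →L[ℝ] Esp N) (μ : Measure (CodeSpace m))
    (ω : List (Fin m) → Esp N) : Measure (Esp N) :=
  μ.map (proj T ω)

/-- The `r`-mesh cube `[j₁ r, (j₁ + 1) r) × ⋯ × [j_N r, (j_N + 1) r)`. -/
def meshCube {N : ℕ} (r : ℝ) (j : Fin N → ℤ) : Set (Esp N) :=
  {x | ∀ l, x l ∈ Set.Ico ((j l : ℝ) * r) (((j l : ℝ) + 1) * r)}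

/-- The moment sum `M_r(q) = ∑_C τ(C)^q` over the `r`-mesh cubes. For `q > 0` the cubes of measure
zero contribute nothing. -/
def momentSum {N : ℕ} (τ : Measure (Esp N)) (q r : ℝ) : ℝ≥0∞ :=
  ∑' j : Fin N → ℤ, τ (meshCube r j) ^ q

/-- The lower generalised `q`-dimension `liminf_{r → 0+} log M_r(q) / ((q - 1) log r)`. -/
def lowerDim {N : ℕ} (τ : Measure (Esp N)) (q : ℝ) : EReal :=
  liminf (fun r : ℝ => ENNReal.log (momentSum τ q r) / (((q - 1) * Real.log r : ℝ) : EReal))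
    (𝓝[>] (0 : ℝ))

end AlmostSelfAffine

end

/-!
Write `M_r(q)` for the moment sum at scale `r`.

Lower bound. Conditionally on everything outside a cylinder `C_w`, the projection of a point of
`C_w` is an affine image under `T_w` of a random vector with bounded density, so it hits a given
cube of side `r` with probability `≲ r^s / φ^s(T_w)` when `s ≤ N`. Hence distinct subcylinders of
`C_w` rarely charge the same cube: the contribution of `C_w` to `𝔼 M_r(q)` is at most `1 + δ` times
the sum of those of its subcylinders, plus `≲ r^{s(q-1)} φ^s(T_w)^{1-q} μ(C_w)^q`. Iterating over
words until `‖T_w‖ ≤ r`, the factors `(1 + δ)^{|w|}` are absorbed by passing from `φ^s` to `φ^t`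
with `t > s`, and `𝔼 M_r(q) ≲ r^{s(q-1)}` follows from the convergence of the series at `t`.
Summing over dyadic `r` gives `M_r(q) ≲ r^{s'(q-1)}` almost surely for `s' < s`.

Upper bound, for every bounded realisation of `ω`. The image of `C_w` lies in a translate of an
ellipsoid with axes proportional to the singular values of `T_w`. If `r` is comparable to the last
singular value that enters `φ^s`, this ellipsoid meets `≲ φ^s(T_w) / r^s` cubes of side `r`, and
Hölder's inequality bounds `φ^s(T_w)^{1-q} μ(C_w)^q` by `r^{-s(q-1)}` times the contribution of
`C_w` to `M_r(q)`. If `s` is below the lower dimension, then summing over words and over dyadic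
`r` shows that the series converges at `s`.
-/

noncomputable section

namespace AlmostSelfAffine

/-! ### Singular values -/

section SingularValues

variable {E F : Type*} [NormedAddCommGroup E] [InnerProductSpace ℝ E] [FiniteDimensional ℝ E]
  [NormedAddCommGroup F] [InnerProductSpace ℝ F] [FiniteDimensional ℝ F]

theorem exists_orthonormalBasis_norm_apply_sq (T : E →ₗ[ℝ] F) {n : ℕ}
    (hn : Module.finrank ℝ E = n) :
    ∃ b : OrthonormalBasis (Fin n) ℝ E, ∀ z,
      ‖T z‖ ^ 2 = ∑ i : Fin n, (T.singularValues i * b.repr z i) ^ 2 := by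
  have hsymm := T.isSymmetric_adjoint_comp_self
  refine ⟨hsymm.eigenvectorBasis hn, fun z => ?_⟩
  set b := hsymm.eigenvectorBasis hn with hb
  calc ‖T z‖ ^ 2 = inner ℝ z ((LinearMap.adjoint T ∘ₗ T) z) := by
        rw [LinearMap.comp_apply, LinearMap.adjoint_inner_right, real_inner_self_eq_norm_sq]
    _ = ∑ i, inner ℝ (b.repr z i) (b.repr ((LinearMap.adjoint T ∘ₗ T) z) i) := by
        rw [← b.repr.inner_map_map, PiLp.inner_apply]
    _ = _ := Finset.sum_congr rfl fun i _ => by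
        rw [hsymm.eigenvectorBasis_apply_self_apply hn z i, mul_pow, T.sq_singularValues_fin hn i,
          ← hb, RCLike.inner_apply, conj_trivial, RCLike.ofReal_real_eq_id, id]
        ring

theorem singularValues_le_opNorm (T : E →L[ℝ] F) (i : ℕ) :
    T.toLinearMap.singularValues i ≤ ‖T‖ := by
  by_cases hi : i < Module.finrank ℝ E
  · obtain ⟨b, hb⟩ := exists_orthonormalBasis_norm_apply_sq T.toLinearMap rfl
    have hsq : T.toLinearMap.singularValues i ^ 2 = ‖T (b ⟨i, hi⟩)‖ ^ 2 := by
      simp [← ContinuousLinearMap.coe_coe, hb, ite_pow]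
    rw [sq_eq_sq₀ (LinearMap.singularValues_nonneg _ _) (norm_nonneg _)] at hsq
    simpa [hsq] using T.le_opNorm (b ⟨i, hi⟩)
  · rw [LinearMap.singularValues_of_finrank_le _ (not_lt.1 hi)]
    exact norm_nonneg _

end SingularValues

section SingularValueFunction

variable {N : ℕ} {s t : ℝ≥0} {T : Esp N →L[ℝ] Esp N} {r : ℝ}

theorem singularValues_pos (hT : Function.Injective T) {i : ℕ} (hi : i < N) :
    0 < T.toLinearMap.singularValues i :=
  (T.toLinearMap.injective_iff_forall_lt_finrank_singularValues_pos.1 hT) i (by simpa using hi)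

/-- The exponent of the singular value of index `i` (counted from `0`) in `φ^s`: for `s ≤ N` this is
`s - i` clamped to `[0, 1]`. -/
def svWeight (N : ℕ) (s : ℝ≥0) (i : ℕ) : ℝ :=
  if (s : ℝ) ≤ N then max 0 (min 1 ((s : ℝ) - i)) else s / N

/-- The index (counted from `0`) of the last singular value that enters `φ^s` for `s ≤ N`; it is the
`j - 1` of the paper, where `j - 1 < s ≤ j`, and `0` for `s = 0`. -/
def criticalIndex (s : ℝ≥0) : ℕ := ⌈s⌉₊ - 1

theorem criticalIndex_le (s : ℝ≥0) : (criticalIndex s : ℝ) ≤ s := by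
  rcases Nat.eq_zero_or_pos (criticalIndex s) with h | h
  · simp [h]
  · exact_mod_cast (Nat.lt_ceil.1 (show criticalIndex s < ⌈s⌉₊ by
      rw [criticalIndex] at h ⊢; omega)).le

theorem le_criticalIndex_add_one (s : ℝ≥0) : (s : ℝ) ≤ criticalIndex s + 1 := by
  have hceil : ⌈s⌉₊ ≤ criticalIndex s + 1 := by rw [criticalIndex]; omega
  exact_mod_cast (Nat.le_ceil s).trans (Nat.cast_le.2 hceil)

theorem criticalIndex_lt (hN : 0 < N) (hs : (s : ℝ) ≤ N) : criticalIndex s < N := by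
  have hceil : ⌈s⌉₊ ≤ N := Nat.ceil_le.2 (by exact_mod_cast hs)
  rw [criticalIndex]
  omega

theorem svWeight_of_lt_criticalIndex (hs : (s : ℝ) ≤ N) {i : ℕ} (hi : i < criticalIndex s) :
    svWeight N s i = 1 := by
  have h : (i : ℝ) + 1 ≤ criticalIndex s := by exact_mod_cast hi
  rw [svWeight, if_pos hs, min_eq_left (by linarith [criticalIndex_le s]),
    max_eq_right zero_le_one]

theorem svWeight_criticalIndex (hs : (s : ℝ) ≤ N) :
    svWeight N s (criticalIndex s) = s - criticalIndex s := by
  rw [svWeight, if_pos hs, min_eq_right (by linarith [le_criticalIndex_add_one s]),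
    max_eq_right (by linarith [criticalIndex_le s])]

theorem svWeight_of_criticalIndex_lt (hs : (s : ℝ) ≤ N) {i : ℕ} (hi : criticalIndex s < i) :
    svWeight N s i = 0 := by
  have h : (criticalIndex s : ℝ) + 1 ≤ i := by exact_mod_cast hi
  rw [svWeight, if_pos hs, min_eq_right (by linarith [le_criticalIndex_add_one s]),
    max_eq_left (by linarith [le_criticalIndex_add_one s])]

theorem svWeight_nonneg (N : ℕ) (s : ℝ≥0) (i : ℕ) : 0 ≤ svWeight N s i := by
  rw [svWeight]
  split_ifs
  · exact le_max_left _ _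
  · positivity

theorem svWeight_le_one (hs : (s : ℝ) ≤ N) (i : ℕ) : svWeight N s i ≤ 1 := by
  rw [svWeight, if_pos hs]
  exact max_le zero_le_one (min_le_left _ _)

theorem svWeight_mono (hN : 0 < N) (hs : (s : ℝ) ≤ N) (hst : s ≤ t) (i : ℕ) :
    svWeight N s i ≤ svWeight N t i := by
  by_cases ht : (t : ℝ) ≤ N
  · rw [svWeight, svWeight, if_pos hs, if_pos ht]
    gcongr
  · refine (svWeight_le_one hs i).trans ?_
    rw [svWeight, if_neg ht, le_div_iff₀ (by positivity)]
    linarith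

theorem sum_range_max_min_sub (s : ℝ≥0) (n : ℕ) :
    ∑ i ∈ Finset.range n, max 0 (min 1 ((s : ℝ) - i)) = min (s : ℝ) n := by
  induction n with
  | zero => simp
  | succ n ih =>
    rw [Finset.sum_range_succ, ih]
    push_cast
    grind

theorem sum_svWeight (hN : 0 < N) (s : ℝ≥0) : ∑ i ∈ Finset.range N, svWeight N s i = s := by
  by_cases hs : (s : ℝ) ≤ N
  · simp only [svWeight, if_pos hs, sum_range_max_min_sub, min_eq_left hs]
  · have : (N : ℝ) ≠ 0 := by positivity
    simp only [svWeight, if_neg hs, Finset.sum_const, Finset.card_range, nsmul_eq_mul]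
    field_simp

theorem rpow_eq_prod_rpow_svWeight (hN : 0 < N) (s : ℝ≥0) (hr : 0 < r) :
    r ^ (s : ℝ) = ∏ i ∈ Finset.range N, r ^ svWeight N s i := by
  rw [← Real.rpow_sum_of_pos hr, sum_svWeight hN]

theorem singularValueFunction_eq_prod (hN : 0 < N) (s : ℝ≥0) (T : Esp N →L[ℝ] Esp N) :
    singularValueFunction s T =
      ∏ i ∈ Finset.range N, T.toLinearMap.singularValues i ^ svWeight N s i := by
  rw [singularValueFunction]
  split_ifs with hs
  · have hsub : Finset.range (criticalIndex s + 1) ⊆ Finset.range N :=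
      Finset.range_subset_range.2 (criticalIndex_lt hN hs)
    have hone : ∀ i ∈ Finset.range N, i ∉ Finset.range (criticalIndex s + 1) →
        T.toLinearMap.singularValues i ^ svWeight N s i = 1 := fun i _ hi => by
      rw [Finset.mem_range, not_lt] at hi
      rw [svWeight_of_criticalIndex_lt hs hi, Real.rpow_zero]
    rw [← Finset.prod_subset hsub hone, Finset.prod_range_succ, svWeight_criticalIndex hs,
      criticalIndex]
    congr 1
    exact Finset.prod_congr rfl fun i hi => by
      rw [svWeight_of_lt_criticalIndex hs (Finset.mem_range.1 hi), Real.rpow_one]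
  · simp only [svWeight, if_neg hs]
    rw [Real.finsetProd_rpow _ _ fun i _ => LinearMap.singularValues_nonneg _ _]

theorem singularValueFunction_zero (T : Esp N →L[ℝ] Esp N) : singularValueFunction 0 T = 1 := by
  simp [singularValueFunction]

theorem singularValueFunction_pos (hN : 0 < N) (s : ℝ≥0) (hT : Function.Injective T) :
    0 < singularValueFunction s T := by
  rw [singularValueFunction_eq_prod hN]
  exact Finset.prod_pos fun i hi =>
    Real.rpow_pos_of_pos (singularValues_pos hT (Finset.mem_range.1 hi)) _

theorem singularValueFunction_le_mul_norm_rpow (hN : 0 < N) (hs : (s : ℝ) ≤ N) (hst : s ≤ t)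
    (hT : Function.Injective T) :
    singularValueFunction t T ≤ singularValueFunction s T * ‖T‖ ^ ((t : ℝ) - s) := by
  have hnorm : 0 < ‖T‖ := (singularValues_pos hT hN).trans_le (singularValues_le_opNorm T 0)
  rw [singularValueFunction_eq_prod hN, singularValueFunction_eq_prod hN, Real.rpow_sub hnorm,
    rpow_eq_prod_rpow_svWeight hN t hnorm, rpow_eq_prod_rpow_svWeight hN s hnorm,
    ← Finset.prod_div_distrib, ← Finset.prod_mul_distrib]
  refine Finset.prod_le_prod (fun i _ => Real.rpow_nonneg (LinearMap.singularValues_nonneg _ _) _)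
    fun i hi => ?_
  have hpos := singularValues_pos hT (Finset.mem_range.1 hi)
  calc T.toLinearMap.singularValues i ^ svWeight N t i
      = T.toLinearMap.singularValues i ^ svWeight N s i *
          T.toLinearMap.singularValues i ^ (svWeight N t i - svWeight N s i) := by
        rw [← Real.rpow_add hpos, add_sub_cancel]
    _ ≤ T.toLinearMap.singularValues i ^ svWeight N s i *
          ‖T‖ ^ (svWeight N t i - svWeight N s i) := by
        gcongr
        · exact sub_nonneg.2 (svWeight_mono hN hs hst i)
        · exact singularValues_le_opNorm T i
    _ = _ := by rw [Real.rpow_sub hnorm]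

theorem singularValueFunction_le_norm_rpow (hN : 0 < N) (s : ℝ≥0) (hT : Function.Injective T) :
    singularValueFunction s T ≤ ‖T‖ ^ (s : ℝ) := by
  simpa [singularValueFunction_zero] using
    singularValueFunction_le_mul_norm_rpow hN (s := 0) (t := s) (by simp) zero_le hT

theorem prod_min_one_div_singularValues_le (hN : 0 < N) (hs : (s : ℝ) ≤ N)
    (hT : Function.Injective T) (hr : 0 < r) :
    ∏ i ∈ Finset.range N, min 1 (r / T.toLinearMap.singularValues i) ≤
      r ^ (s : ℝ) / singularValueFunction s T := by
  have hpos : ∀ i ∈ Finset.range N, 0 < T.toLinearMap.singularValues i := fun i hi =>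
    singularValues_pos hT (Finset.mem_range.1 hi)
  rw [singularValueFunction_eq_prod hN, rpow_eq_prod_rpow_svWeight hN s hr,
    ← Finset.prod_div_distrib]
  refine Finset.prod_le_prod (fun i hi => le_min zero_le_one (div_pos hr (hpos i hi)).le)
    fun i hi => ?_
  rw [← Real.div_rpow hr.le (hpos i hi).le]
  rcases le_total 1 (r / T.toLinearMap.singularValues i) with h1 | h1
  · rw [min_eq_left h1]
    exact Real.one_le_rpow h1 (svWeight_nonneg N s i)
  · rw [min_eq_right h1]
    exact Real.self_le_rpow_of_le_one (div_pos hr (hpos i hi)).le h1 (svWeight_le_one hs i)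

theorem prod_max_one_singularValues_div_le (hN : 0 < N) (hs : (s : ℝ) ≤ N)
    (hT : Function.Injective T) (hr : 0 < r)
    (hle : T.toLinearMap.singularValues (criticalIndex s) ≤ r)
    (hge : r ≤ 2 * T.toLinearMap.singularValues (criticalIndex s)) :
    ∏ i ∈ Finset.range N, max 1 (T.toLinearMap.singularValues i / r) ≤
      2 ^ N * (singularValueFunction s T / r ^ (s : ℝ)) := by
  have htwo : (2 : ℝ) ^ N = ∏ i ∈ Finset.range N, 2 := by simp
  rw [singularValueFunction_eq_prod hN, rpow_eq_prod_rpow_svWeight hN s hr,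
    ← Finset.prod_div_distrib, htwo, ← Finset.prod_mul_distrib]
  refine Finset.prod_le_prod (fun _ _ => le_max_of_le_left zero_le_one) fun i hi => ?_
  have hpos : 0 < T.toLinearMap.singularValues i := singularValues_pos hT (Finset.mem_range.1 hi)
  rw [← Real.div_rpow hpos.le hr.le]
  have hanti := T.toLinearMap.singularValues_antitone
  rcases lt_trichotomy i (criticalIndex s) with h | h | h
  · have hhalf : 1 ≤ 2 * (T.toLinearMap.singularValues i / r) := by
      rw [← mul_div_assoc, le_div_iff₀ hr]
      linarith [hanti h.le]
    rw [svWeight_of_lt_criticalIndex hs h, Real.rpow_one]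
    exact max_le hhalf (by linarith [div_pos hpos hr])
  · have hle1 : T.toLinearMap.singularValues i / r ≤ 1 := (div_le_one hr).2 (h ▸ hle)
    have hhalf : 1 ≤ 2 * (T.toLinearMap.singularValues i / r) := by
      rw [← mul_div_assoc, le_div_iff₀ hr, h]
      linarith
    rw [max_eq_left hle1]
    linarith [Real.self_le_rpow_of_le_one (div_pos hpos hr).le hle1 (svWeight_le_one hs i)]
  · rw [svWeight_of_criticalIndex_lt hs h, Real.rpow_zero,
      max_eq_left ((div_le_one hr).2 ((hanti h.le).trans hle))]
    norm_num

end SingularValueFunction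

/-! ### Volumes of bounded sets with small linear image -/

section Volume

theorem volume_le_prod_of_abs_repr_sub_le {ι E : Type*} [Fintype ι] [NormedAddCommGroup E]
    [InnerProductSpace ℝ E] [FiniteDimensional ℝ E] [MeasurableSpace E] [BorelSpace E]
    (b : OrthonormalBasis ι ℝ E) {A : Set E} (c : E) (w : ι → ℝ)
    (hA : ∀ z ∈ A, ∀ i, |b.repr (z - c) i| ≤ w i) :
    volume A ≤ ∏ i, ENNReal.ofReal (2 * w i) := by
  set box : Set (ι → ℝ) := Set.pi Set.univ fun i => Set.Icc (b.repr c i - w i) (b.repr c i + w i)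
  have hbox : MeasurableSet box := MeasurableSet.univ_pi fun i => measurableSet_Icc
  have hsub : A ⊆ b.repr ⁻¹' (WithLp.ofLp ⁻¹' box) := fun z hz i _ => by
    have h := abs_le.1 (hA z hz i)
    simp only [map_sub, PiLp.sub_apply] at h
    constructor <;> linarith
  calc volume A ≤ volume (b.repr ⁻¹' (WithLp.ofLp ⁻¹' box)) := measure_mono hsub
    _ = volume (WithLp.ofLp ⁻¹' box : Set (EuclideanSpace ℝ ι)) :=
        b.measurePreserving_repr.measure_preimage
          ((PiLp.volume_preserving_ofLp ι).measurable hbox).nullMeasurableSet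
    _ = volume box := (PiLp.volume_preserving_ofLp ι).measure_preimage hbox.nullMeasurableSet
    _ = ∏ i, ENNReal.ofReal (2 * w i) := by
        rw [volume_pi_pi]
        refine Finset.prod_congr rfl fun i _ => ?_
        rw [Real.volume_Icc]
        ring_nf

theorem abs_repr_le_norm {ι E : Type*} [Fintype ι] [NormedAddCommGroup E] [InnerProductSpace ℝ E]
    (b : OrthonormalBasis ι ℝ E) (z : E) (i : ι) : |b.repr z i| ≤ ‖z‖ := by
  simpa using PiLp.norm_apply_le (b.repr z) i

theorem volume_le_of_norm_image_sub_le {N : ℕ} (hN : 0 < N) {s : ℝ≥0} (hs : (s : ℝ) ≤ N)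
    {T : Esp N →L[ℝ] Esp N} (hT : Function.Injective T) {R r : ℝ} (hR : 1 ≤ R) (hr : 0 < r)
    {A : Set (Esp N)} (hA : ∀ z ∈ A, ‖z‖ ≤ R) (hTA : ∀ z ∈ A, ∀ z' ∈ A, ‖T (z - z')‖ ≤ r) :
    volume A ≤ ENNReal.ofReal ((4 * R) ^ N * (r ^ (s : ℝ) / singularValueFunction s T)) := by
  rcases A.eq_empty_or_nonempty with rfl | ⟨c, hc⟩
  · simp
  obtain ⟨b, hb⟩ := exists_orthonormalBasis_norm_apply_sq T.toLinearMap finrank_euclideanSpace_fin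
  set σ := T.toLinearMap.singularValues
  have hσ : ∀ i : Fin N, 0 < σ i := fun i => singularValues_pos hT i.2
  have hbox : ∀ z ∈ A, ∀ i, |b.repr (z - c) i| ≤ 2 * R * min 1 (r / σ i) := fun z hz i => by
    have hR2 : |b.repr (z - c) i| ≤ 2 * R := calc
      _ ≤ ‖z - c‖ := abs_repr_le_norm b _ i
      _ ≤ ‖z‖ + ‖c‖ := norm_sub_le _ _
      _ ≤ 2 * R := by linarith [hA z hz, hA c hc]
    have hrσ : |b.repr (z - c) i| ≤ r / σ i := by
      rw [le_div_iff₀ (hσ i), mul_comm, ← abs_of_pos (hσ i), ← abs_mul]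
      refine (abs_le_of_sq_le_sq ?_ (norm_nonneg _)).trans (hTA z hz c hc)
      rw [← ContinuousLinearMap.coe_coe, hb]
      exact Finset.single_le_sum (f := fun i : Fin N => (σ i * b.repr (z - c) i) ^ 2)
        (fun i _ => sq_nonneg _) (Finset.mem_univ i)
    rw [mul_min_of_nonneg _ _ (by positivity), mul_one]
    exact le_min hR2 (hrσ.trans (le_mul_of_one_le_left (div_pos hr (hσ i)).le (by linarith)))
  calc volume A ≤ ∏ i : Fin N, ENNReal.ofReal (2 * (2 * R * min 1 (r / σ i))) :=
        volume_le_prod_of_abs_repr_sub_le b c _ hbox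
    _ = ENNReal.ofReal (∏ i : Fin N, 4 * R * min 1 (r / σ i)) := by
        rw [ENNReal.ofReal_prod_of_nonneg fun i _ => by have := hσ i; positivity]
        ring_nf
    _ ≤ _ := by
        refine ENNReal.ofReal_le_ofReal ?_
        rw [Finset.prod_mul_distrib, Finset.prod_const, Finset.card_univ, Fintype.card_fin,
          Fin.prod_univ_eq_prod_range (fun i => min 1 (r / σ i)) N]
        gcongr
        exact prod_min_one_div_singularValues_le hN hs hT hr

end Volume

/-! ### Mesh cubes -/

section MeshCube

variable {N : ℕ} {r : ℝ}

theorem mem_meshCube_iff (hr : 0 < r) {j : Fin N → ℤ} {x : Esp N} :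
    x ∈ meshCube r j ↔ (fun l => ⌊x l / r⌋) = j := by
  simp only [meshCube, Set.mem_ofPred_eq, Set.mem_Ico, funext_iff, Int.floor_eq_iff,
    le_div_iff₀ hr, div_lt_iff₀ hr]

theorem mem_meshCube_floor (hr : 0 < r) (x : Esp N) : x ∈ meshCube r fun l => ⌊x l / r⌋ :=
  (mem_meshCube_iff hr).2 rfl

theorem measurableSet_meshCube (r : ℝ) (j : Fin N → ℤ) :
    MeasurableSet (meshCube r j : Set (Esp N)) := by
  simp only [meshCube, Set.ofPred_forall]
  exact MeasurableSet.iInter fun l => measurableSet_Ico.preimage (by fun_prop)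

theorem pairwise_disjoint_meshCube (hr : 0 < r) :
    Pairwise (Function.onFun Disjoint fun j : Fin N → ℤ => (meshCube r j : Set (Esp N))) :=
  fun _ _ hij => Set.disjoint_left.2 fun _ hi hj =>
    hij (((mem_meshCube_iff hr).1 hi).symm.trans ((mem_meshCube_iff hr).1 hj))

theorem iUnion_meshCube (hr : 0 < r) :
    ⋃ j : Fin N → ℤ, (meshCube r j : Set (Esp N)) = Set.univ :=
  Set.eq_univ_of_forall fun x => Set.mem_iUnion.2 ⟨_, mem_meshCube_floor hr x⟩

theorem sum_sq_le_sq_mul_of_abs_le {f : Fin N → ℝ} (hf : ∀ i, |f i| ≤ r) :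
    ∑ i, f i ^ 2 ≤ (N * r) ^ 2 := by
  calc ∑ i, f i ^ 2 ≤ ∑ _i : Fin N, r ^ 2 :=
        Finset.sum_le_sum fun i _ => sq_le_sq.2 ((hf i).trans (le_abs_self r))
    _ = N * r ^ 2 := by simp
    _ ≤ (N * r) ^ 2 := by
        rw [mul_pow]
        gcongr
        exact_mod_cast Nat.le_self_pow two_ne_zero N

theorem norm_sub_le_of_mem_meshCube (hr : 0 < r) {j : Fin N → ℤ} {x y : Esp N}
    (hx : x ∈ meshCube r j) (hy : y ∈ meshCube r j) : ‖x - y‖ ≤ N * r := by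
  have hcoord : ∀ l, |(x - y) l| ≤ r := fun l => by
    rw [PiLp.sub_apply, abs_le]
    obtain ⟨hx₁, hx₂⟩ := hx l
    obtain ⟨hy₁, hy₂⟩ := hy l
    constructor <;> linarith
  refine le_of_sq_le_sq ?_ (by positivity)
  simpa only [EuclideanSpace.real_norm_sq_eq] using sum_sq_le_sq_mul_of_abs_le hcoord

/-- The indices of the `r`-mesh cubes that contain a point at distance at most `n * r` from `y`, and
possibly some more. -/
def nearbyCubes (r : ℝ) (n : ℕ) (y : Esp N) : Finset (Fin N → ℤ) :=
  Fintype.piFinset fun l => Finset.Icc (⌊y l / r⌋ - (n + 1)) (⌊y l / r⌋ + (n + 1))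

theorem card_nearbyCubes (r : ℝ) (n : ℕ) (y : Esp N) :
    (nearbyCubes r n y).card = (2 * n + 3) ^ N := by
  have hcard : ∀ k : ℤ, (k + (n + 1) + 1 - (k - (n + 1))).toNat = 2 * n + 3 := fun k => by omega
  simp [nearbyCubes, hcard]

theorem floor_div_mem_nearbyCubes (hr : 0 < r) {n : ℕ} {x y : Esp N} (hxy : ‖x - y‖ ≤ n * r) :
    (fun l => ⌊x l / r⌋) ∈ nearbyCubes r n y := by
  refine Fintype.mem_piFinset.2 fun l => Finset.mem_Icc.2 ?_
  have hl : |x l / r - y l / r| ≤ n := by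
    rw [← sub_div, abs_div, abs_of_pos hr, div_le_iff₀ hr]
    exact le_trans (by simpa using PiLp.norm_apply_le (x - y) l) hxy
  have hx := Int.floor_le (x l / r)
  have hx' := Int.lt_floor_add_one (x l / r)
  have hy := Int.floor_le (y l / r)
  have hy' := Int.lt_floor_add_one (y l / r)
  rw [abs_le] at hl
  constructor
  · have : ((⌊y l / r⌋ - (n + 1) : ℤ) : ℝ) < ⌊x l / r⌋ := by push_cast; linarith
    exact_mod_cast this.le
  · have : ((⌊x l / r⌋ : ℤ) : ℝ) < (⌊y l / r⌋ + (n + 1) : ℤ) := by push_cast; linarith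
    exact_mod_cast this.le

theorem floor_div_mem_Icc_of_abs_le {x y : ℝ} (hr : 0 < r) (hxy : |x| ≤ y) :
    ⌊x / r⌋ ∈ Finset.Icc (-⌊y / r⌋ - 1) ⌊y / r⌋ := by
  obtain ⟨hlow, hup⟩ := abs_le.1 hxy
  refine Finset.mem_Icc.2 ⟨Int.le_floor.2 ?_, by gcongr⟩
  have hneg : -(y / r) ≤ x / r := by rw [← neg_div]; gcongr
  push_cast
  linarith [Int.lt_floor_add_one (y / r)]

theorem card_Icc_neg_floor_le {x R : ℝ} (hx : 0 ≤ x) (hR : 0 ≤ R) :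
    ((Finset.Icc (-⌊R * x⌋ - 1) ⌊R * x⌋).card : ℝ) ≤ (2 * R + 2) * max 1 x := by
  have hfloor : 0 ≤ ⌊R * x⌋ := Int.floor_nonneg.2 (by positivity)
  have hcard : ((Finset.Icc (-⌊R * x⌋ - 1) ⌊R * x⌋).card : ℤ) = 2 * ⌊R * x⌋ + 2 := by
    rw [Int.card_Icc, Int.toNat_of_nonneg (by omega)]
    ring
  have hcard' : ((Finset.Icc (-⌊R * x⌋ - 1) ⌊R * x⌋).card : ℝ) = 2 * ⌊R * x⌋ + 2 := by
    exact_mod_cast hcard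
  have hmax : R * x ≤ R * max 1 x := by gcongr; exact le_max_right 1 x
  rw [hcard']
  linarith [Int.floor_le (R * x), le_max_left 1 x]

/-- The cells `{z | c z = k}` are boxes along the right singular vectors of `T`, of side `r / α_i`
in the direction of the singular value `α_i`. -/
theorem exists_cells_norm_image_sub_le (T : Esp N →L[ℝ] Esp N) {R : ℝ} (hR : 0 ≤ R) (hr : 0 < r) :
    ∃ (c : Esp N → Fin N → ℤ) (G : Finset (Fin N → ℤ)), (∀ z, ‖z‖ ≤ R → c z ∈ G) ∧
      (∀ z z', c z = c z' → ‖T (z - z')‖ ≤ N * r) ∧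
      (G.card : ℝ) ≤
        (2 * R + 2) ^ N * ∏ i ∈ Finset.range N, max 1 (T.toLinearMap.singularValues i / r) := by
  obtain ⟨b, hb⟩ := exists_orthonormalBasis_norm_apply_sq T.toLinearMap finrank_euclideanSpace_fin
  set σ := T.toLinearMap.singularValues
  have hσ : ∀ i : Fin N, 0 ≤ σ i := fun i => T.toLinearMap.singularValues_nonneg i
  refine ⟨fun z i => ⌊σ i * b.repr z i / r⌋,
    Fintype.piFinset fun i => Finset.Icc (-⌊R * (σ i / r)⌋ - 1) ⌊R * (σ i / r)⌋,
    fun z hz => Fintype.mem_piFinset.2 fun i => ?_, fun z z' hzz' => ?_, ?_⟩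
  · rw [mul_div_left_comm, ← mul_div_assoc]
    refine floor_div_mem_Icc_of_abs_le hr ?_
    rw [abs_mul, abs_of_nonneg (hσ i)]
    have := hσ i
    gcongr
    exact (abs_repr_le_norm b z i).trans hz
  · have hcoord : ∀ i : Fin N, |σ i * b.repr (z - z') i| ≤ r := fun i => by
      have h := Int.abs_sub_lt_one_of_floor_eq_floor (congrFun hzz' i)
      rw [← sub_div, ← mul_sub, abs_div, abs_of_pos hr, div_lt_one hr] at h
      simpa only [map_sub, PiLp.sub_apply] using h.le
    refine le_of_sq_le_sq ?_ (by positivity)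
    rw [← ContinuousLinearMap.coe_coe, hb]
    exact sum_sq_le_sq_mul_of_abs_le hcoord
  · rw [Fintype.card_piFinset, Nat.cast_prod]
    calc _ ≤ ∏ i : Fin N, (2 * R + 2) * max 1 (σ i / r) :=
          Finset.prod_le_prod (fun i _ => by positivity)
            fun i _ => card_Icc_neg_floor_le (div_nonneg (hσ i) hr.le) hR
      _ = _ := by
          rw [Finset.prod_mul_distrib, Finset.prod_const, Finset.card_univ, Fintype.card_fin,
            Fin.prod_univ_eq_prod_range (fun i => max 1 (σ i / r)) N]

theorem exists_cover_meshCube (T : Esp N →L[ℝ] Esp N) {R : ℝ} (hR : 0 ≤ R) (hr : 0 < r)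
    (x₀ : Esp N) :
    ∃ F : Finset (Fin N → ℤ), (∀ z, ‖z‖ ≤ R → x₀ + T z ∈ ⋃ j ∈ F, meshCube r j) ∧
      (F.card : ℝ) ≤ (2 * N + 3) ^ N * (2 * R + 2) ^ N *
        ∏ i ∈ Finset.range N, max 1 (T.toLinearMap.singularValues i / r) := by
  classical
  obtain ⟨c, G, hmem, hclose, hcard⟩ := exists_cells_norm_image_sub_le T hR hr
  choose! rep hrep using fun (k : Fin N → ℤ) (hk : ∃ z, c z = k) => hk
  refine ⟨G.biUnion fun k => nearbyCubes r N (x₀ + T (rep k)), fun z hz => ?_, ?_⟩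
  · have hnear : ‖(x₀ + T z) - (x₀ + T (rep (c z)))‖ ≤ N * r := by
      rw [add_sub_add_left_eq_sub, ← map_sub]
      exact hclose _ _ (hrep _ ⟨z, rfl⟩).symm
    simp only [Set.mem_iUnion, exists_prop, Finset.mem_biUnion]
    exact ⟨_, ⟨c z, hmem z hz, floor_div_mem_nearbyCubes hr hnear⟩, mem_meshCube_floor hr _⟩
  · calc ((G.biUnion fun k => nearbyCubes r N (x₀ + T (rep k))).card : ℝ)
        ≤ (G.card * (2 * N + 3) ^ N : ℕ) := by
          gcongr
          exact Finset.card_biUnion_le_card_mul _ _ _ fun k _ => (card_nearbyCubes r N _).le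
      _ ≤ _ := by
          push_cast
          rw [mul_comm, mul_assoc]
          gcongr

end MeshCube

/-! ### Moment sums -/

theorem ennreal_rpow_eq_mul_rpow_sub_one {q : ℝ} (hq : 1 ≤ q) (x : ℝ≥0∞) :
    x ^ q = x * x ^ (q - 1) := by
  calc x ^ q = x ^ (1 + (q - 1)) := by rw [add_sub_cancel]
    _ = x * x ^ (q - 1) := by
        rw [ENNReal.rpow_add_of_nonneg _ _ zero_le_one (sub_nonneg.2 hq), ENNReal.rpow_one]

theorem tsum_rpow_le_rpow_tsum {ι : Type*} (f : ι → ℝ≥0∞) {q : ℝ} (hq : 1 ≤ q) :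
    ∑' i, f i ^ q ≤ (∑' i, f i) ^ q := by
  calc ∑' i, f i ^ q ≤ ∑' i, f i * (∑' i, f i) ^ (q - 1) := by
        refine ENNReal.tsum_le_tsum fun i => ?_
        rw [ennreal_rpow_eq_mul_rpow_sub_one hq]
        gcongr
        exact ENNReal.le_tsum i
    _ = (∑' i, f i) ^ q := by
        rw [ENNReal.tsum_mul_right, ← ennreal_rpow_eq_mul_rpow_sub_one hq]

theorem measure_rpow_le_of_subset_biUnion {X ι : Type*} [MeasurableSpace X] (τ : Measure X) {q : ℝ}
    (hq : 1 ≤ q) (F : Finset ι) (C : ι → Set X) {A : Set X} (hA : A ⊆ ⋃ i ∈ F, C i) :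
    τ A ^ q ≤ (F.card : ℝ≥0∞) ^ (q - 1) * ∑ i ∈ F, τ (C i ∩ A) ^ q := by
  calc τ A ^ q ≤ (∑ i ∈ F, τ (C i ∩ A)) ^ q := by
        gcongr
        calc τ A = τ (⋃ i ∈ F, C i ∩ A) := by
              rw [← Set.iUnion₂_inter, Set.inter_eq_right.2 hA]
          _ ≤ ∑ i ∈ F, τ (C i ∩ A) := measure_biUnion_finset_le _ _
    _ ≤ _ := ENNReal.rpow_sum_le_const_mul_sum_rpow F _ hq

section MomentSum

variable {N : ℕ} (τ : Measure (Esp N)) {q r : ℝ}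

theorem tsum_measure_meshCube (hr : 0 < r) :
    ∑' j : Fin N → ℤ, τ (meshCube r j) = τ Set.univ := by
  rw [← iUnion_meshCube hr, measure_iUnion (pairwise_disjoint_meshCube hr)
    (measurableSet_meshCube r)]

theorem tsum_measure_meshCube_inter (hr : 0 < r) (A : Set (Esp N)) :
    ∑' j : Fin N → ℤ, τ (meshCube r j ∩ A) = τ A := by
  simpa [Measure.restrict_apply (measurableSet_meshCube r _)] using
    tsum_measure_meshCube (τ.restrict A) hr

theorem momentSum_le_rpow (hq : 1 ≤ q) (hr : 0 < r) : momentSum τ q r ≤ τ Set.univ ^ q := by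
  rw [← tsum_measure_meshCube τ hr]
  exact tsum_rpow_le_rpow_tsum _ hq

theorem exists_cover_meshCube_of_le {r' : ℝ} (hr' : 0 < r') (hrr' : r ≤ r') (j : Fin N → ℤ) :
    ∃ F : Finset (Fin N → ℤ), F.card = 2 ^ N ∧
      (meshCube r j : Set (Esp N)) ⊆ ⋃ j' ∈ F, meshCube r' j' := by
  refine ⟨Fintype.piFinset fun l => {⌊j l * r / r'⌋, ⌊j l * r / r'⌋ + 1}, by simp, fun x hx => ?_⟩
  refine Set.mem_biUnion (Fintype.mem_piFinset.2 fun l => ?_) (mem_meshCube_floor hr' x)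
  obtain ⟨hlow, hup⟩ := hx l
  have hfloor : ⌊j l * r / r'⌋ ≤ ⌊x l / r'⌋ := by gcongr
  have hfloor' : ⌊x l / r'⌋ ≤ ⌊j l * r / r'⌋ + 1 := by
    rw [← Int.floor_add_one]
    refine Int.floor_le_floor ?_
    rw [div_add_one hr'.ne']
    gcongr
    linarith
  simp only [Finset.mem_insert, Finset.mem_singleton]
  omega

theorem momentSum_le_momentSum (hq : 1 ≤ q) {r' : ℝ} (hr : 0 < r) (hrr' : r ≤ r') :
    momentSum τ q r ≤ ((2 : ℝ≥0∞) ^ N) ^ (q - 1) * momentSum τ q r' := by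
  calc momentSum τ q r
      ≤ ∑' j : Fin N → ℤ, ((2 : ℝ≥0∞) ^ N) ^ (q - 1) *
          ∑' j' : Fin N → ℤ, τ (meshCube r' j' ∩ meshCube r j) ^ q := by
        refine ENNReal.tsum_le_tsum fun j => ?_
        obtain ⟨F, hcard, hcover⟩ := exists_cover_meshCube_of_le (hr.trans_le hrr') hrr' j
        refine (measure_rpow_le_of_subset_biUnion τ hq F _ hcover).trans ?_
        rw [hcard, Nat.cast_pow, Nat.cast_ofNat]
        gcongr
        exact ENNReal.sum_le_tsum F
    _ = ((2 : ℝ≥0∞) ^ N) ^ (q - 1) * ∑' j' : Fin N → ℤ, ∑' j : Fin N → ℤ,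
          τ (meshCube r j ∩ meshCube r' j') ^ q := by
        rw [ENNReal.tsum_mul_left, ENNReal.tsum_comm]
        simp only [Set.inter_comm]
    _ ≤ ((2 : ℝ≥0∞) ^ N) ^ (q - 1) * momentSum τ q r' := by
        rw [momentSum]
        gcongr with j'
        refine (tsum_rpow_le_rpow_tsum _ hq).trans ?_
        rw [tsum_measure_meshCube_inter τ hr]

end MomentSum

/-! ### The lower dimension -/

theorem exists_pow_half_mem_Icc {a : ℝ} (ha : 0 < a) (ha_one : a ≤ 1) :
    ∃ n : ℕ, (1 / 2 : ℝ) ^ n ∈ Set.Icc a (2 * a) := by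
  obtain ⟨n, hlt, hle⟩ := exists_nat_pow_near_of_lt_one ha ha_one
    (by norm_num : (0 : ℝ) < 1 / 2) (by norm_num)
  rw [pow_succ] at hlt
  exact ⟨n, hle, by linarith⟩

section LowerDim

variable {N : ℕ} (τ : Measure (Esp N)) {q s : ℝ}

theorem coe_le_log_div_iff {r : ℝ} (hr0 : 0 < r) (hr1 : r < 1) (hq : 1 < q) (x : ℝ≥0∞) :
    (s : EReal) ≤ ENNReal.log x / (((q - 1) * Real.log r : ℝ) : EReal) ↔
      x ≤ ENNReal.ofReal (r ^ (s * (q - 1))) := by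
  set c := (q - 1) * Real.log r
  have hc : c < 0 := mul_neg_of_pos_of_neg (sub_pos.2 hq) (Real.log_neg hr0 hr1)
  have hs : (s : EReal) = ((s * c : ℝ) : EReal) / (c : EReal) := by
    rw [← EReal.coe_div, mul_div_cancel_right₀ _ hc.ne]
  have hlog : ENNReal.log (ENNReal.ofReal (r ^ (s * (q - 1)))) = ((s * c : ℝ) : EReal) := by
    rw [ENNReal.log_ofReal_of_pos (Real.rpow_pos_of_pos hr0 _), Real.log_rpow hr0, mul_assoc]
  rw [hs, (EReal.strictAnti_div_right_of_neg (EReal.coe_neg'.2 hc)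
    (EReal.coe_ne_bot c)).le_iff_ge, ← hlog, ENNReal.log_le_log_iff]

theorem eventually_rpow_lt_const {t c : ℝ} (ht : 0 < t) (hc : 0 < c) :
    ∀ᶠ r in 𝓝[>] (0 : ℝ), r ^ t < c := by
  have hlim := (Real.continuousAt_rpow_const 0 t (Or.inr ht.le)).tendsto
  rw [Real.zero_rpow ht.ne'] at hlim
  exact (hlim.mono_left nhdsWithin_le_nhds).eventually_lt_const hc

theorem eventually_mem_Ioo_zero_one : ∀ᶠ r in 𝓝[>] (0 : ℝ), r ∈ Set.Ioo (0 : ℝ) 1 :=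
  Ioo_mem_nhdsGT one_pos

theorem mul_rpow_lt_rpow_of_lt {r C t : ℝ} (hr : 0 < r) (hsmall : r ^ ((s - t) * (q - 1)) < C⁻¹)
    (hC : 0 < C) : C * r ^ (s * (q - 1)) < r ^ (t * (q - 1)) := by
  have hsplit : r ^ (s * (q - 1)) = r ^ ((s - t) * (q - 1)) * r ^ (t * (q - 1)) := by
    rw [← Real.rpow_add hr, ← add_mul, sub_add_cancel]
  rw [hsplit, ← mul_assoc]
  refine mul_lt_of_lt_one_left (Real.rpow_pos_of_pos hr _) ?_
  rwa [mul_comm, ← lt_div_iff₀ hC, one_div]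

theorem le_lowerDim_of_eventually_le {C : ℝ} (hq : 1 < q) (hC : 0 < C)
    (h : ∀ᶠ r in 𝓝[>] (0 : ℝ), momentSum τ q r ≤ ENNReal.ofReal (C * r ^ (s * (q - 1)))) :
    (s : EReal) ≤ lowerDim τ q := by
  refine EReal.ge_of_forall_gt_iff_ge.1 fun t hts => ?_
  have hexp : 0 < (s - t) * (q - 1) :=
    mul_pos (sub_pos.2 (EReal.coe_lt_coe_iff.1 hts)) (sub_pos.2 hq)
  refine le_liminf_of_le (by isBoundedDefault) ?_
  filter_upwards [h, eventually_mem_Ioo_zero_one,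
    eventually_rpow_lt_const hexp (inv_pos.2 hC)] with r hle ⟨hr0, hr1⟩ hsmall
  rw [coe_le_log_div_iff hr0 hr1 hq]
  exact hle.trans (ENNReal.ofReal_le_ofReal (mul_rpow_lt_rpow_of_lt hr0 hsmall hC).le)

theorem eventually_momentSum_le (hq : 1 < q) (h : (s : EReal) < lowerDim τ q) :
    ∀ᶠ r in 𝓝[>] (0 : ℝ), momentSum τ q r ≤ ENNReal.ofReal (r ^ (s * (q - 1))) := by
  filter_upwards [eventually_lt_of_lt_liminf h, eventually_mem_Ioo_zero_one] with r hlt ⟨hr0, hr1⟩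
  exact (coe_le_log_div_iff hr0 hr1 hq _).1 hlt.le

theorem lowerDim_le_of_eventually_le {c : ℝ} (hq : 1 < q) (hc : 0 < c)
    (h : ∀ᶠ r in 𝓝[>] (0 : ℝ), ENNReal.ofReal (c * r ^ (s * (q - 1))) ≤ momentSum τ q r) :
    lowerDim τ q ≤ (s : EReal) := by
  by_contra! hlt
  obtain ⟨t, hst, ht⟩ := EReal.lt_iff_exists_real_btwn.1 hlt
  have hexp : 0 < (t - s) * (q - 1) :=
    mul_pos (sub_pos.2 (EReal.coe_lt_coe_iff.1 hst)) (sub_pos.2 hq)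
  obtain ⟨r, hlow, hup, hr, hsmall⟩ := (h.and ((eventually_momentSum_le τ hq ht).and
    (eventually_mem_Ioo_zero_one.and (eventually_rpow_lt_const hexp hc)))).exists
  have hle := (ENNReal.ofReal_le_ofReal_iff (Real.rpow_nonneg hr.1.le _)).1 (hlow.trans hup)
  have hgt := mul_rpow_lt_rpow_of_lt hr.1 ((inv_inv c).symm ▸ hsmall) (inv_pos.2 hc)
  rw [inv_mul_lt_iff₀ hc] at hgt
  exact hgt.not_ge hle

theorem le_lowerDim_of_dyadic (hq : 1 < q) (hs : 0 ≤ s) {A : ℝ≥0∞} (hA : A ≠ ∞)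
    (h : ∀ n : ℕ, momentSum τ q ((1 / 2) ^ n) ≤
      A * ENNReal.ofReal (((1 / 2 : ℝ) ^ n) ^ (s * (q - 1)))) :
    (s : EReal) ≤ lowerDim τ q := by
  have : 0 ≤ s * (q - 1) := mul_nonneg hs (by linarith)
  set B : ℝ≥0∞ := ((2 : ℝ≥0∞) ^ N) ^ (q - 1) * A + 1 with hB
  have hBtop : B ≠ ∞ := ENNReal.add_ne_top.2 ⟨ENNReal.mul_ne_top
    (ENNReal.rpow_ne_top_of_nonneg (by linarith) (by simp)) hA, by simp⟩
  have hBpos : 0 < B.toReal := ENNReal.toReal_pos (by simp [hB]) hBtop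
  refine le_lowerDim_of_eventually_le τ hq (C := B.toReal * 2 ^ (s * (q - 1))) (by positivity) ?_
  filter_upwards [eventually_mem_Ioo_zero_one] with r ⟨hr0, hr1⟩
  obtain ⟨n, hle, hge⟩ := exists_pow_half_mem_Icc hr0 hr1.le
  calc momentSum τ q r ≤ ((2 : ℝ≥0∞) ^ N) ^ (q - 1) * momentSum τ q ((1 / 2) ^ n) :=
        momentSum_le_momentSum τ hq.le hr0 hle
    _ ≤ ((2 : ℝ≥0∞) ^ N) ^ (q - 1) *
          (A * ENNReal.ofReal (((1 / 2 : ℝ) ^ n) ^ (s * (q - 1)))) := by gcongr; exact h n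
    _ ≤ B * ENNReal.ofReal ((2 * r) ^ (s * (q - 1))) := by
        rw [← mul_assoc]
        gcongr
        exact le_self_add
    _ = ENNReal.ofReal (B.toReal * 2 ^ (s * (q - 1)) * r ^ (s * (q - 1))) := by
        rw [mul_assoc, ← Real.mul_rpow zero_le_two hr0.le, ENNReal.ofReal_mul hBpos.le,
          ENNReal.ofReal_toReal hBtop]

variable [IsFiniteMeasure τ]

theorem lowerDim_nonneg (hq : 1 < q) : 0 ≤ lowerDim τ q := by
  simpa using le_lowerDim_of_dyadic τ hq le_rfl (A := τ Set.univ ^ q)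
    (ENNReal.rpow_ne_top_of_nonneg (by linarith) (measure_ne_top _ _)) fun n => by
      simpa using momentSum_le_rpow τ hq.le (r := (1 / 2) ^ n) (by positivity)

theorem exists_momentSum_le (hq : 1 < q) (hs : 0 ≤ s) (h : (s : EReal) < lowerDim τ q) :
    ∃ A : ℝ≥0∞, A ≠ ∞ ∧ ∀ r : ℝ, 0 < r →
      momentSum τ q r ≤ A * ENNReal.ofReal (r ^ (s * (q - 1))) := by
  have : 0 ≤ s * (q - 1) := mul_nonneg hs (by linarith)
  obtain ⟨r₀, hr₀, hsmall⟩ := mem_nhdsGT_iff_exists_Ioo_subset.1 (eventually_momentSum_le τ hq h)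
  have hr₀_pos : 0 < r₀ := hr₀
  have hpow : 0 < r₀ ^ (s * (q - 1)) := Real.rpow_pos_of_pos hr₀ _
  refine ⟨1 + τ Set.univ ^ q / ENNReal.ofReal (r₀ ^ (s * (q - 1))), ?_, fun r hr => ?_⟩
  · refine ENNReal.add_ne_top.2 ⟨by simp, ENNReal.div_ne_top ?_ (by simpa using hpow)⟩
    exact ENNReal.rpow_ne_top_of_nonneg (by linarith) (measure_ne_top _ _)
  · rcases lt_or_ge r r₀ with hlt | hge
    · exact (hsmall ⟨hr, hlt⟩).trans (le_mul_of_one_le_left zero_le le_self_add)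
    · calc momentSum τ q r ≤ τ Set.univ ^ q := momentSum_le_rpow τ hq.le hr
        _ = τ Set.univ ^ q / ENNReal.ofReal (r₀ ^ (s * (q - 1))) *
              ENNReal.ofReal (r₀ ^ (s * (q - 1))) :=
            (ENNReal.div_mul_cancel (by simpa using hpow) (by simp)).symm
        _ ≤ _ := by
            gcongr
            exact le_add_self

end LowerDim

/-! ### A power inequality with small off-diagonal coefficients -/

section PowerInequality

variable {q : ℝ} {δ : ℝ≥0}

theorem exists_one_add_rpow_le (hq : 0 < q) (hδ : 0 < δ) :
    ∃ θ : ℝ≥0, 0 < θ ∧ (1 + θ) ^ q ≤ 1 + δ := by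
  have hlt : 1 < (1 + δ) ^ q⁻¹ := NNReal.one_lt_rpow (by simpa) (by positivity)
  refine ⟨(1 + δ) ^ q⁻¹ - 1, tsub_pos_of_lt hlt, ?_⟩
  rw [add_tsub_cancel_of_le hlt.le, NNReal.rpow_inv_rpow hq.ne']

/-- Either `b` is negligible against `a` (the first term suffices), or `a` is at most a constant
multiple of `z` (the last one does), or `b / z` is large (the middle one does). -/
theorem exists_add_rpow_le (n : ℕ) (hq : 1 < q) (hδ : 0 < δ) :
    ∃ C : ℝ≥0, ∀ z a b : ℝ≥0, z ≠ 0 → a + b ≤ n * a →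
      (a + b) ^ q ≤ (1 + δ) * a ^ q + δ * (a ^ q * b / z) + C * z ^ (q - 1) * (a + b) := by
  obtain ⟨θ, hθ, hθδ⟩ := exists_one_add_rpow_le (zero_lt_one.trans hq) hδ
  set L : ℝ≥0 := n ^ q / (δ * θ) with hL
  refine ⟨n ^ q * L ^ (q - 1), fun z a b hz hab => ?_⟩
  rw [add_assoc]
  rcases le_or_gt b (θ * a) with hb | hb
  · refine le_add_of_le_of_nonneg ?_ zero_le
    calc (a + b) ^ q ≤ ((1 + θ) * a) ^ q := by
          rw [one_add_mul]
          gcongr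
      _ = (1 + θ) ^ q * a ^ q := NNReal.mul_rpow
      _ ≤ (1 + δ) * a ^ q := by gcongr
  refine le_add_of_nonneg_of_le zero_le ?_
  have hpow : (a + b) ^ q ≤ n ^ q * a ^ q := by
    rw [← NNReal.mul_rpow]
    gcongr
  rcases le_or_gt a (L * z) with ha | ha
  · refine le_add_of_nonneg_of_le zero_le (hpow.trans ?_)
    calc (n : ℝ≥0) ^ q * a ^ q = n ^ q * (a ^ (q - 1) * a) := by
          rw [← NNReal.rpow_add_one' (by linarith), sub_add_cancel]
      _ ≤ n ^ q * ((L * z) ^ (q - 1) * (a + b)) := by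
          have : 0 ≤ q - 1 := by linarith
          gcongr
          exact le_self_add
      _ = n ^ q * L ^ (q - 1) * z ^ (q - 1) * (a + b) := by
          rw [NNReal.mul_rpow]
          ring
  · refine le_add_of_le_of_nonneg (hpow.trans ?_) zero_le
    have hLa : L ≤ a / z := ((lt_div_iff₀ (pos_iff_ne_zero.2 hz)).2 ha).le
    calc (n : ℝ≥0) ^ q * a ^ q = δ * (a ^ q * (θ * L)) := by
          rw [hL]
          field_simp
      _ ≤ δ * (a ^ q * (θ * (a / z))) := by gcongr
      _ = δ * (a ^ q * (θ * a) / z) := by ring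
      _ ≤ δ * (a ^ q * b / z) := by gcongr

theorem exists_sum_rpow_le (ι : Type*) [Fintype ι] [DecidableEq ι] (hq : 1 < q) (hδ : 0 < δ) :
    ∃ C : ℝ≥0, ∀ z : ℝ≥0, z ≠ 0 → ∀ Y : ι → ℝ≥0,
      (∑ a, Y a) ^ q ≤ (1 + δ) * ∑ a, Y a ^ q +
        δ * ∑ a, ∑ b ∈ Finset.univ.erase a, Y a ^ q * Y b / z + C * z ^ (q - 1) * ∑ a, Y a := by
  obtain ⟨C, hC⟩ := exists_add_rpow_le (Fintype.card ι) hq hδ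
  refine ⟨C, fun z hz Y => ?_⟩
  rcases isEmpty_or_nonempty ι with _ | _
  · simp [NNReal.zero_rpow (by linarith : q ≠ 0)]
  obtain ⟨a, -, ha⟩ := Finset.exists_max_image Finset.univ Y Finset.univ_nonempty
  have hsum : Y a + ∑ b ∈ Finset.univ.erase a, Y b = ∑ b, Y b :=
    Finset.add_sum_erase _ _ (Finset.mem_univ a)
  have hcard : ∑ b, Y b ≤ Fintype.card ι * Y a := by
    simpa using Finset.sum_le_card_nsmul Finset.univ Y (Y a) ha
  have hmain := hC z (Y a) (∑ b ∈ Finset.univ.erase a, Y b) hz (hsum ▸ hcard)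
  rw [hsum] at hmain
  refine hmain.trans ?_
  gcongr
  · exact Finset.single_le_sum (f := fun b => Y b ^ q) (fun _ _ => zero_le) (Finset.mem_univ a)
  · rw [Finset.mul_sum, Finset.sum_div]
    exact Finset.single_le_sum (f := fun a => ∑ b ∈ Finset.univ.erase a, Y a ^ q * Y b / z)
      (fun _ _ => zero_le) (Finset.mem_univ a)

theorem exists_ennreal_sum_rpow_le (ι : Type*) [Fintype ι] [DecidableEq ι] (hq : 1 < q)
    (hδ : 0 < δ) :
    ∃ C : ℝ≥0, ∀ z : ℝ≥0∞, z ≠ 0 → z ≠ ∞ → ∀ Y : ι → ℝ≥0∞, (∀ a, Y a ≠ ∞) →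
      (∑ a, Y a) ^ q ≤ (1 + δ) * ∑ a, Y a ^ q +
        δ * ∑ a, ∑ b ∈ Finset.univ.erase a, Y a ^ q * Y b / z + C * z ^ (q - 1) * ∑ a, Y a := by
  obtain ⟨C, hC⟩ := exists_sum_rpow_le ι hq hδ
  refine ⟨C, fun z hz hz_top Y hY => ?_⟩
  lift z to ℝ≥0 using hz_top
  lift Y to ι → ℝ≥0 using hY
  have hz0 : z ≠ 0 := ENNReal.coe_ne_zero.1 hz
  have hq0 : 0 ≤ q := by linarith
  have hq1 : 0 ≤ q - 1 := by linarith
  simp only [← ENNReal.coe_rpow_of_nonneg _ hq0, ← ENNReal.coe_rpow_of_nonneg _ hq1,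
    ← ENNReal.ofNNReal_finsetSum, ← ENNReal.coe_mul, ← ENNReal.coe_div hz0, ← ENNReal.coe_one,
    ← ENNReal.coe_add]
  exact ENNReal.coe_le_coe.2 (hC z hz0 Y)

end PowerInequality

/-! ### Words and cylinders -/

section Words

variable {m : ℕ}

/-- The infinite word obtained from `i` by deleting its first `k` letters. -/
def dropFirst (k : ℕ) (i : CodeSpace m) : CodeSpace m := fun n => i (k + n)

theorem length_curtail (i : CodeSpace m) (k : ℕ) : (curtail i k).length = k := by
  simp [curtail]

theorem curtail_zero (i : CodeSpace m) : curtail i 0 = [] := by simp [curtail]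

theorem curtail_succ (i : CodeSpace m) (k : ℕ) : curtail i (k + 1) = curtail i k ++ [i k] := by
  rw [curtail, List.ofFn_succ', List.concat_eq_append]
  rfl

theorem curtail_add (i : CodeSpace m) (k l : ℕ) :
    curtail i (k + l) = curtail i k ++ curtail (dropFirst k i) l := by
  induction l with
  | zero => simp [curtail_zero]
  | succ l ih => rw [← add_assoc, curtail_succ, ih, curtail_succ, List.append_assoc, dropFirst]

theorem mem_wordCylinder_of_isPrefix_curtail {v : List (Fin m)} {i : CodeSpace m} {k : ℕ}
    (h : v <+: curtail i k) : i ∈ wordCylinder v := by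
  have hlen : v.length ≤ k := (length_curtail i k) ▸ h.length_le
  obtain ⟨l, rfl⟩ := Nat.exists_eq_add_of_le hlen
  obtain ⟨t, ht⟩ := h
  rw [curtail_add] at ht
  exact (List.append_inj ht (length_curtail _ _).symm).1.symm

theorem curtail_eq_take {w : List (Fin m)} {i : CodeSpace m} (hi : i ∈ wordCylinder w) {l : ℕ}
    (hl : l ≤ w.length) : curtail i l = w.take l := by
  have hw : curtail i w.length = w := hi
  obtain ⟨k, hk⟩ := Nat.exists_eq_add_of_le hl
  rw [hk, curtail_add] at hw
  rw [← hw, List.take_left' (length_curtail _ _)]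

theorem wordCylinder_nil : wordCylinder ([] : List (Fin m)) = Set.univ := by
  ext i
  simp [wordCylinder, curtail_zero]

theorem mem_wordCylinder_append {w : List (Fin m)} {a : Fin m} {i : CodeSpace m} :
    i ∈ wordCylinder (w ++ [a]) ↔ i ∈ wordCylinder w ∧ i w.length = a := by
  simp only [wordCylinder, Set.mem_ofPred_eq, List.length_append, List.length_singleton,
    curtail_succ]
  refine ⟨fun h => ?_, fun ⟨hw, ha⟩ => by rw [hw, ha]⟩
  simpa using List.append_inj h (length_curtail _ _)

theorem wordCylinder_append_subset (w : List (Fin m)) (a : Fin m) :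
    wordCylinder (w ++ [a]) ⊆ wordCylinder w :=
  fun _ hi => (mem_wordCylinder_append.1 hi).1

theorem iUnion_wordCylinder_append (w : List (Fin m)) :
    ⋃ a, wordCylinder (w ++ [a]) = wordCylinder w := by
  ext i
  simp [mem_wordCylinder_append]

theorem pairwise_disjoint_wordCylinder_append (w : List (Fin m)) :
    Pairwise (Function.onFun Disjoint fun a => wordCylinder (w ++ [a])) :=
  fun _ _ hab => Set.disjoint_left.2 fun _ ha hb =>
    hab ((mem_wordCylinder_append.1 ha).2.symm.trans (mem_wordCylinder_append.1 hb).2)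

theorem measurable_restrictFirst (k : ℕ) :
    Measurable fun (i : CodeSpace m) (l : Fin k) => i l :=
  measurable_pi_lambda _ fun _ => measurable_pi_apply _

theorem measurableSet_wordCylinder (w : List (Fin m)) : MeasurableSet (wordCylinder w) :=
  measurable_restrictFirst w.length (Set.toFinite {v | List.ofFn v = w}).measurableSet

theorem measure_wordCylinder_eq_sum (μ : Measure (CodeSpace m)) (w : List (Fin m)) :
    μ (wordCylinder w) = ∑ a, μ (wordCylinder (w ++ [a])) := by
  rw [← iUnion_wordCylinder_append, measure_iUnion (pairwise_disjoint_wordCylinder_append w)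
    fun a => measurableSet_wordCylinder _, tsum_fintype]

theorem restrict_wordCylinder_eq_sum (μ : Measure (CodeSpace m)) (w : List (Fin m)) :
    μ.restrict (wordCylinder w) = ∑ a, μ.restrict (wordCylinder (w ++ [a])) := by
  rw [← iUnion_wordCylinder_append, Measure.restrict_iUnion
    (pairwise_disjoint_wordCylinder_append w) fun a => measurableSet_wordCylinder _,
    Measure.sum_fintype]

theorem sum_ofFn_succ {M : Type*} [AddCommMonoid M] (f : List (Fin m) → M) (k : ℕ) :
    ∑ i : Fin (k + 1) → Fin m, f (List.ofFn i) =
      ∑ i : Fin k → Fin m, ∑ a, f (List.ofFn i ++ [a]) := by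
  rw [← (Fin.snocEquiv fun _ : Fin (k + 1) => Fin m).sum_comp, Fintype.sum_prod_type_right]
  refine Finset.sum_congr rfl fun i _ => Finset.sum_congr rfl fun a _ => ?_
  rw [List.ofFn_succ', List.concat_eq_append]
  simp [Fin.snocEquiv]

theorem sum_measure_wordCylinder (μ : Measure (CodeSpace m)) (k : ℕ) :
    ∑ i : Fin k → Fin m, μ (wordCylinder (List.ofFn i)) = μ Set.univ := by
  induction k with
  | zero => simp [wordCylinder_nil]
  | succ k ih =>
    rw [sum_ofFn_succ fun w => μ (wordCylinder w), ← ih]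
    exact Finset.sum_congr rfl fun i _ => (measure_wordCylinder_eq_sum μ _).symm

end Words

/-! ### Products of contractions -/

section Contractions

variable {m N : ℕ} {T : Fin m → Esp N →L[ℝ] Esp N}

/-- The largest of the operator norms `‖T₁‖, …, ‖T_m‖` (`0` if `m = 0`). -/
def contractionRatio (T : Fin m → Esp N →L[ℝ] Esp N) : ℝ≥0 :=
  Finset.univ.sup fun i => ‖T i‖₊

theorem norm_le_contractionRatio (i : Fin m) : ‖T i‖ ≤ contractionRatio T :=
  NNReal.coe_le_coe.2 (Finset.le_sup (f := fun i => ‖T i‖₊) (Finset.mem_univ i))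

theorem contractionRatio_lt_one (hT : ∀ i, ‖T i‖ < 1) : (contractionRatio T : ℝ) < 1 :=
  NNReal.coe_lt_one.2 ((Finset.sup_lt_iff one_pos).2 fun i _ => hT i)

theorem wordMap_cons (a : Fin m) (w : List (Fin m)) :
    wordMap T (a :: w) = T a * wordMap T w := by
  simp [wordMap]

theorem wordMap_append_apply (v w : List (Fin m)) (x : Esp N) :
    wordMap T (v ++ w) x = wordMap T v (wordMap T w x) := by
  simp [wordMap]

theorem norm_wordMap_le (w : List (Fin m)) :
    ‖wordMap T w‖ ≤ (contractionRatio T : ℝ) ^ w.length := by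
  induction w with
  | nil => exact ContinuousLinearMap.norm_id_le
  | cons a w ih =>
    rw [wordMap_cons, List.length_cons, pow_succ']
    exact (norm_mul_le _ _).trans (mul_le_mul (norm_le_contractionRatio a) ih (norm_nonneg _)
      (NNReal.coe_nonneg _))

theorem wordMap_injective (hT : ∀ i, Function.Injective (T i)) (w : List (Fin m)) :
    Function.Injective (wordMap T w) := by
  induction w with
  | nil => simpa [wordMap] using Function.injective_id
  | cons a w ih =>
    rw [wordMap_cons]
    exact (hT a).comp ih

end Contractions

/-! ### The projection -/

section Projection

variable {m N : ℕ} {T : Fin m → Esp N →L[ℝ] Esp N} {ω : List (Fin m) → Esp N} {R : ℝ}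

theorem norm_proj_term_le (hω : ∀ w, ‖ω w‖ ≤ R) (i : CodeSpace m) (k : ℕ) :
    ‖wordMap T (curtail i k) (ω (curtail i (k + 1)))‖ ≤ R * (contractionRatio T : ℝ) ^ k := by
  have hnorm := norm_wordMap_le (T := T) (curtail i k)
  rw [length_curtail] at hnorm
  calc _ ≤ ‖wordMap T (curtail i k)‖ * ‖ω (curtail i (k + 1))‖ := ContinuousLinearMap.le_opNorm _ _
    _ ≤ (contractionRatio T : ℝ) ^ k * R :=
        mul_le_mul hnorm (hω _) (norm_nonneg _) (by positivity)
    _ = _ := mul_comm _ _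

theorem summable_proj (hT : ∀ i, ‖T i‖ < 1) (hω : ∀ w, ‖ω w‖ ≤ R) (i : CodeSpace m) :
    Summable fun k => wordMap T (curtail i k) (ω (curtail i (k + 1))) :=
  Summable.of_norm_bounded ((summable_geometric_of_lt_one (contractionRatio T).2
    (contractionRatio_lt_one hT)).mul_left R) (norm_proj_term_le hω i)

theorem norm_proj_le (hT : ∀ i, ‖T i‖ < 1) (hω : ∀ w, ‖ω w‖ ≤ R) (i : CodeSpace m) :
    ‖proj T ω i‖ ≤ R * (1 - (contractionRatio T : ℝ))⁻¹ :=
  tsum_of_norm_bounded ((hasSum_geometric_of_lt_one (contractionRatio T).2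
    (contractionRatio_lt_one hT)).mul_left R) (norm_proj_term_le hω i)

theorem proj_eq_sum_add (hT : ∀ i, ‖T i‖ < 1) (hω : ∀ w, ‖ω w‖ ≤ R) (i : CodeSpace m) (k : ℕ) :
    proj T ω i = ∑ l ∈ Finset.range k, wordMap T (curtail i l) (ω (curtail i (l + 1))) +
      wordMap T (curtail i k) (proj T (fun u => ω (curtail i k ++ u)) (dropFirst k i)) := by
  rw [proj, ← (summable_proj hT hω i).sum_add_tsum_nat_add k, proj,
    ContinuousLinearMap.map_tsum _ (summable_proj hT (fun u => hω _) _)]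
  congr 1
  refine tsum_congr fun l => ?_
  rw [add_comm l k, add_assoc k l 1, curtail_add, curtail_add, wordMap_append_apply]

theorem proj_congr {ω' : List (Fin m) → Esp N} {i : CodeSpace m}
    (h : ∀ k, ω (curtail i (k + 1)) = ω' (curtail i (k + 1))) : proj T ω i = proj T ω' i :=
  tsum_congr fun k => by rw [h]

theorem measurable_proj_term {Ω : Type*} [MeasurableSpace Ω] {ω : List (Fin m) → Ω → Esp N}
    (hω : ∀ w, Measurable (ω w)) (k : ℕ) :
    Measurable fun p : Ω × CodeSpace m =>
      wordMap T (curtail p.2 k) (ω (curtail p.2 (k + 1)) p.1) := by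
  have hfin : Measurable fun p : Ω × (Fin (k + 1) → Fin m) =>
      wordMap T (List.ofFn fun l : Fin k => p.2 l.castSucc) (ω (List.ofFn p.2) p.1) :=
    measurable_from_prod_countable_left fun v =>
      (wordMap T (List.ofFn fun l : Fin k => v l.castSucc)).measurable.comp (hω (List.ofFn v))
  exact hfin.comp (measurable_fst.prodMk ((measurable_restrictFirst (k + 1)).comp measurable_snd))

theorem measurable_proj (hT : ∀ i, ‖T i‖ < 1) {Ω : Type*} [MeasurableSpace Ω]
    {ω : List (Fin m) → Ω → Esp N} (hbound : ∀ w x, ‖ω w x‖ ≤ R) (hω : ∀ w, Measurable (ω w)) :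
    Measurable fun p : Ω × CodeSpace m => proj T (fun w => ω w p.1) p.2 :=
  measurable_of_tendsto_metrizable
    (f := fun n (p : Ω × CodeSpace m) => ∑ k ∈ Finset.range n,
      wordMap T (curtail p.2 k) (ω (curtail p.2 (k + 1)) p.1))
    (fun _ => Finset.measurable_fun_sum _ fun k _ => measurable_proj_term hω k)
    (tendsto_pi_nhds.2 fun p =>
      (summable_proj hT (fun w => hbound w p.1) p.2).hasSum.tendsto_sum_nat)

theorem measurable_proj_apply (hT : ∀ i, ‖T i‖ < 1) (hω : ∀ w, ‖ω w‖ ≤ R) :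
    Measurable (proj T ω) :=
  (measurable_proj hT (Ω := Unit) (ω := fun w _ => ω w) (fun w _ => hω w)
    fun _ => measurable_const).comp (measurable_prodMk_left (x := ()))

end Projection

/-! ### Independence of disjoint subfamilies -/

section Independence

variable {ι Ω β : Type*} [MeasurableSpace β]

/-- The σ-algebra on `Ω` generated by the members of the family `ω` with index in `S`. -/
abbrev sigmaOn (ω : ι → Ω → β) (S : Set ι) : MeasurableSpace Ω :=
  ⨆ u ∈ S, MeasurableSpace.comap (ω u) inferInstance

theorem measurable_sigmaOn (ω : ι → Ω → β) {S : Set ι} {u : ι} (hu : u ∈ S) :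
    Measurable[sigmaOn ω S] (ω u) :=
  measurable_iff_comap_le.2 (le_iSup₂_of_le u hu le_rfl)

variable [mΩ : MeasurableSpace Ω] {P : Measure Ω} {ω : ι → Ω → β}

theorem sigmaOn_le (hω : ∀ u, Measurable (ω u)) (S : Set ι) : sigmaOn ω S ≤ mΩ :=
  iSup₂_le fun u _ => (hω u).comap_le

theorem indepFun_of_sigmaOn (hω : ∀ u, Measurable (ω u)) (hindep : iIndepFun ω P) {S S' : Set ι}
    (hS : Disjoint S S') {γ γ' : Type*} [MeasurableSpace γ] [MeasurableSpace γ'] {f : Ω → γ}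
    {g : Ω → γ'} (hf : Measurable[sigmaOn ω S] f) (hg : Measurable[sigmaOn ω S'] g) :
    IndepFun f g P := by
  rw [IndepFun_iff_Indep]
  exact indep_of_indep_of_le (indep_iSup_of_disjoint (fun u => (hω u).comap_le)
    hindep.iIndep hS) hf.comap_le hg.comap_le

theorem lintegral_of_indepFun [IsFiniteMeasure P] {γ γ' : Type*} [MeasurableSpace γ]
    [MeasurableSpace γ'] {f : Ω → γ} {g : Ω → γ'} (hf : Measurable f) (hg : Measurable g)
    (hfg : IndepFun f g P) {F : γ × γ' → ℝ≥0∞} (hF : Measurable F) :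
    ∫⁻ x, F (f x, g x) ∂P = ∫⁻ x, ∫⁻ y, F (f x, g y) ∂P ∂P := by
  have hprod := (indepFun_iff_map_prod_eq_prod_map_map hf.aemeasurable hg.aemeasurable).1 hfg
  rw [← lintegral_map (f := F) (g := fun x => (f x, g x)) hF (hf.prodMk hg), hprod,
    lintegral_prod _ hF.aemeasurable, lintegral_map hF.lintegral_prod_right' hf]
  exact lintegral_congr fun x =>
    lintegral_map (f := fun y => F (f x, y)) (hF.comp measurable_prodMk_left) hg

end Independence

section ProjIndependence

variable {m N : ℕ} {Ω : Type*} {ω : List (Fin m) → Ω → Esp N} {R : ℝ}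
  {T : Fin m → Esp N →L[ℝ] Esp N}

theorem measurable_proj_indicator (hT : ∀ i, ‖T i‖ < 1) (hω : ∀ w x, ‖ω w x‖ ≤ R)
    (S : Set (List (Fin m))) (w : List (Fin m)) :
    @Measurable _ _ (@Prod.instMeasurableSpace _ _ (sigmaOn ω S) inferInstance) _
      fun p : Ω × CodeSpace m =>
        proj T (fun u => S.indicator (fun u => ω u p.1) (w ++ u)) p.2 := by
  refine @measurable_proj m N T R hT Ω (sigmaOn ω S)
    (fun u x => S.indicator (fun u => ω u x) (w ++ u)) (fun u x => ?_) (fun u => ?_)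
  · exact (norm_indicator_le_norm_self _ _).trans (hω _ x)
  · by_cases hu : w ++ u ∈ S
    · simp only [Set.indicator_of_mem hu]
      exact measurable_sigmaOn ω hu
    · simp only [Set.indicator_of_notMem hu]
      exact @measurable_const _ _ _ (sigmaOn ω S) _

theorem measurable_proj_of_mem (hT : ∀ i, ‖T i‖ < 1) (hω : ∀ w x, ‖ω w x‖ ≤ R)
    {S : Set (List (Fin m))} {w : List (Fin m)} {j : CodeSpace m}
    (hS : ∀ k, w ++ curtail j (k + 1) ∈ S) :
    Measurable[sigmaOn ω S] fun x => proj T (fun u => ω (w ++ u) x) j := by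
  have hproj : (fun x => proj T (fun u => ω (w ++ u) x) j) =
      fun x => proj T (fun u => S.indicator (fun u => ω u x) (w ++ u)) j :=
    funext fun x => proj_congr (ω := fun u => ω (w ++ u) x) fun k =>
      (Set.indicator_of_mem (hS k) fun u => ω u x).symm
  rw [hproj]
  exact (measurable_proj_indicator hT hω S w).comp (@measurable_prodMk_right _ _ (sigmaOn ω S) _ j)

theorem measurable_projMeasure_apply_of_mem (hT : ∀ i, ‖T i‖ < 1) (hω : ∀ w x, ‖ω w x‖ ≤ R)
    (μ : Measure (CodeSpace m)) [SFinite μ] {S : Set (List (Fin m))}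
    (hS : ∀ᵐ j ∂μ, ∀ k, curtail j (k + 1) ∈ S) {C : Set (Esp N)} (hC : MeasurableSet C) :
    Measurable[sigmaOn ω S] fun x => projMeasure T μ (fun u => ω u x) C := by
  have hind := measurable_proj_indicator hT hω S []
  have hproj : ∀ x, projMeasure T μ (fun u => ω u x) C =
      μ (Prod.mk x ⁻¹' ((fun p : Ω × CodeSpace m =>
        proj T (fun u => S.indicator (fun u => ω u p.1) ([] ++ u)) p.2) ⁻¹' C)) := fun x => by
    rw [projMeasure, Measure.map_apply (measurable_proj_apply hT fun w => hω w x) hC]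
    refine measure_congr ?_
    filter_upwards [hS] with j hj
    have : proj T (fun u => ω u x) j =
        proj T (fun u => S.indicator (fun u => ω u x) ([] ++ u)) j :=
      proj_congr fun k => (Set.indicator_of_mem (hj k) fun u => ω u x).symm
    exact congrArg (· ∈ C) this
  simp only [hproj]
  exact @measurable_measure_prodMk_left _ _ (sigmaOn ω S) _ μ _ _ (hind hC)

theorem measurable_projMeasure_apply [MeasurableSpace Ω] (hT : ∀ i, ‖T i‖ < 1)
    (hmeas : ∀ w, Measurable (ω w)) (hω : ∀ w x, ‖ω w x‖ ≤ R) (μ : Measure (CodeSpace m))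
    [SFinite μ] {C : Set (Esp N)} (hC : MeasurableSet C) :
    Measurable fun x => projMeasure T μ (fun u => ω u x) C :=
  (measurable_projMeasure_apply_of_mem hT hω μ (S := Set.univ) (by simp) hC).mono
    (sigmaOn_le hmeas _) le_rfl

end ProjIndependence

/-! ### Bounded densities of the projections -/

section DensityDecomposition

theorem exists_le_smul_add {E : Type*} [MeasurableSpace E] (ρ ν : Measure E) [IsFiniteMeasure ρ]
    [SigmaFinite ν] (hρ : ρ ≪ ν) {η : ℝ≥0∞} (hη : 0 < η) :
    ∃ (K : ℝ≥0) (κ : Measure E), κ Set.univ ≤ η ∧ ρ ≤ (K : ℝ≥0∞) • ν + κ := by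
  set f := ρ.rnDeriv ν
  have hfm : Measurable f := Measure.measurable_rnDeriv ρ ν
  have hlim : Tendsto (fun n : ℕ => ∫⁻ x, f x - n ∂ν) atTop (𝓝 (∫⁻ _, 0 ∂ν)) := by
    refine tendsto_lintegral_of_dominated_convergence f (fun n => hfm.sub_const _)
      (fun n => Eventually.of_forall fun x => tsub_le_self)
      (Measure.lintegral_rnDeriv_lt_top ρ ν).ne ?_
    filter_upwards [Measure.rnDeriv_lt_top ρ ν] with x hx
    obtain ⟨n, hn⟩ := ENNReal.exists_nat_gt hx.ne
    refine tendsto_const_nhds.congr' ?_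
    filter_upwards [eventually_ge_atTop n] with k hk
    exact (tsub_eq_zero_of_le (hn.le.trans (by exact_mod_cast hk))).symm
  rw [lintegral_zero] at hlim
  obtain ⟨n, hn⟩ := (hlim.eventually_lt_const hη).exists
  refine ⟨n, ν.withDensity fun x => f x - n, ?_, ?_⟩
  · rw [withDensity_apply _ MeasurableSet.univ, Measure.restrict_univ]
    exact hn.le
  · conv_lhs => rw [← Measure.withDensity_rnDeriv_eq ρ ν hρ]
    refine Measure.le_iff.2 fun s hs => ?_
    rw [withDensity_apply _ hs, Measure.add_apply, withDensity_apply _ hs, Measure.smul_apply]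
    calc ∫⁻ x in s, f x ∂ν ≤ ∫⁻ x in s, n + (f x - n) ∂ν :=
          lintegral_mono fun x => le_add_tsub
      _ = _ := by
          rw [lintegral_add_left measurable_const]
          simp

variable {E : Type*} [AddCommGroup E] [MeasurableSpace E] [MeasurableAdd₂ E] {ν ρ ζ κ : Measure E}
  [ν.IsAddLeftInvariant] [IsFiniteMeasure ρ] [IsProbabilityMeasure ζ] {L : E → E}
  {K c d e : ℝ≥0∞}

theorem prod_preimage_add_le (hL : Measurable L) (hLν : ∀ A, ν (L ⁻¹' A) ≤ d * ν A)
    (hζ : ∀ A, MeasurableSet A → ζ A ≤ c * ν A + e) {A : Set E} (hA : MeasurableSet A) :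
    (κ.prod ζ) ((fun p : E × E => p.1 + L p.2) ⁻¹' A) ≤
      κ Set.univ * d * c * ν A + κ Set.univ * e := by
  have hmeas : Measurable fun p : E × E => p.1 + L p.2 :=
    measurable_fst.add (hL.comp measurable_snd)
  rw [Measure.prod_apply (hmeas hA)]
  calc ∫⁻ a, ζ (Prod.mk a ⁻¹' ((fun p : E × E => p.1 + L p.2) ⁻¹' A)) ∂κ
      ≤ ∫⁻ _, c * (d * ν A) + e ∂κ := by
        refine lintegral_mono fun a => (hζ _ (measurable_prodMk_left (hmeas hA))).trans ?_
        gcongr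
        exact (hLν ((fun y => a + y) ⁻¹' A)).trans_eq (by rw [measure_preimage_add])
    _ = (c * (d * ν A) + e) * κ Set.univ := lintegral_const _
    _ = _ := by ring

theorem prod_preimage_add_le_of_le_smul_add [SFinite κ] (hL : Measurable L)
    (hLν : ∀ A, ν (L ⁻¹' A) ≤ d * ν A) (hρ : ρ ≤ K • ν + κ)
    (hζ : ∀ A, MeasurableSet A → ζ A ≤ c * ν A + e) {A : Set E} (hA : MeasurableSet A) :
    (ρ.prod ζ) ((fun p : E × E => p.1 + L p.2) ⁻¹' A) ≤
      (K + κ Set.univ * d * c) * ν A + κ Set.univ * e := by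
  set S : Set (E × E) := (fun p => p.1 + L p.2) ⁻¹' A
  have hS : MeasurableSet S := (measurable_fst.add (hL.comp measurable_snd)) hA
  calc (ρ.prod ζ) S = ∫⁻ z, ρ ((fun a => (a, z)) ⁻¹' S) ∂ζ := Measure.prod_apply_symm hS
    _ ≤ ∫⁻ z, K * ν A + κ ((fun a => (a, z)) ⁻¹' S) ∂ζ := by
        refine lintegral_mono fun z => (hρ _).trans_eq ?_
        have hsection : ν ((fun a => (a, z)) ⁻¹' S) = ν A := measure_preimage_add_right ν (L z) A
        rw [Measure.add_apply, Measure.smul_apply, hsection, smul_eq_mul]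
    _ = K * ν A + (κ.prod ζ) S := by
        rw [lintegral_add_left measurable_const, Measure.prod_apply_symm hS]
        simp
    _ ≤ K * ν A + (κ Set.univ * d * c * ν A + κ Set.univ * e) := by
        gcongr
        exact prod_preimage_add_le hL hLν hζ hA
    _ = _ := by ring

end DensityDecomposition

/-- A family of independent, identically distributed random vectors, indexed by the finite words,
whose law is absolutely continuous and whose norms are everywhere (not just almost surely) at
most `R`. -/
structure IsBoundedIID {m N : ℕ} {Ω : Type*} [MeasurableSpace Ω] (P : Measure Ω)
    (ω : List (Fin m) → Ω → Esp N) (R : ℝ) : Prop where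
  meas : ∀ w, Measurable (ω w)
  indep : iIndepFun ω P
  ident : ∀ v w, IdentDistrib (ω v) (ω w) P P
  ac : ∀ w, P.map (ω w) ≪ volume
  bound : ∀ w x, ‖ω w x‖ ≤ R

section BoundedDensity

variable {m N : ℕ} {Ω : Type*} [MeasurableSpace Ω] {P : Measure Ω} {T : Fin m → Esp N →L[ℝ] Esp N}
  {ω : List (Fin m) → Ω → Esp N} {R : ℝ}

theorem exists_volume_preimage_le (hT : ∀ i, Function.Injective (T i)) :
    ∃ d : ℝ≥0∞, d ≠ ∞ ∧ ∀ i A, volume (T i ⁻¹' A) ≤ d * volume A := by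
  have hdet : ∀ i, LinearMap.det (T i).toLinearMap ≠ 0 := fun i => by
    have := LinearMap.isUnit_iff_ker_eq_bot (T i).toLinearMap |>.2 (LinearMap.ker_eq_bot.2 (hT i))
    exact (LinearMap.isUnit_det _ this).ne_zero
  refine ⟨∑ i, ENNReal.ofReal |(LinearMap.det (T i).toLinearMap)⁻¹|, by simp, fun i A => ?_⟩
  refine (Measure.addHaar_preimage_linearMap volume (hdet i) A).le.trans ?_
  gcongr
  exact Finset.single_le_sum (f := fun i => ENNReal.ofReal |(LinearMap.det (T i).toLinearMap)⁻¹|)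
    (fun _ _ => zero_le) (Finset.mem_univ i)

theorem exists_pos_le_half_mul_le_half {d : ℝ≥0∞} (hd : d ≠ ∞) :
    ∃ η : ℝ≥0∞, 0 < η ∧ η ≤ 2⁻¹ ∧ η * d ≤ 2⁻¹ := by
  have hd1 : d + 1 ≠ ∞ := by simp [hd]
  refine ⟨2⁻¹ * (d + 1)⁻¹, ENNReal.mul_pos (by simp) (ENNReal.inv_ne_zero.2 hd1), ?_, ?_⟩
  · exact mul_le_of_le_one_right' (ENNReal.inv_le_one.2 le_add_self)
  · calc 2⁻¹ * (d + 1)⁻¹ * d ≤ 2⁻¹ * (d + 1)⁻¹ * (d + 1) := by gcongr; exact le_self_add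
      _ = 2⁻¹ := by rw [mul_assoc, ENNReal.inv_mul_cancel (by simp) hd1, mul_one]

theorem proj_eq_add (hT : ∀ i, ‖T i‖ < 1) {ω : List (Fin m) → Esp N} (hω : ∀ w, ‖ω w‖ ≤ R)
    (j : CodeSpace m) :
    proj T ω j = ω [j 0] + T (j 0) (proj T (fun u => ω ([j 0] ++ u)) (dropFirst 1 j)) := by
  have hcurtail : curtail j 1 = [j 0] := by simp [curtail]
  rw [proj_eq_sum_add hT hω j 1]
  simp [hcurtail, curtail_zero, wordMap]

/-- The first letter splits off a term independent of the rest, whose law has a bounded density up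
to the small error `κ`. -/
theorem measure_proj_preimage_le_of_forall [IsProbabilityMeasure P] (h : IsBoundedIID P ω R)
    (hT : ∀ i, ‖T i‖ < 1) {d K c e : ℝ≥0∞} (hd : ∀ i A, volume (T i ⁻¹' A) ≤ d * volume A)
    {κ : Measure (Esp N)} [SFinite κ] (hκ : ∀ w, P.map (ω w) ≤ K • volume + κ)
    (hle : ∀ (w : List (Fin m)) (j : CodeSpace m) (A : Set (Esp N)), MeasurableSet A →
      P ((fun x => proj T (fun u => ω (w ++ u) x) j) ⁻¹' A) ≤ c * volume A + e)
    (w : List (Fin m)) (j : CodeSpace m) {A : Set (Esp N)} (hA : MeasurableSet A) :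
    P ((fun x => proj T (fun u => ω (w ++ u) x) j) ⁻¹' A) ≤
      (K + κ Set.univ * d * c) * volume A + κ Set.univ * e := by
  set v := w ++ [j 0]
  set Z : Ω → Esp N := fun x => proj T (fun u => ω (v ++ u) x) (dropFirst 1 j)
  have hsplit : (fun x => proj T (fun u => ω (w ++ u) x) j) = fun x => ω v x + T (j 0) (Z x) := by
    funext x
    simp only [Z, v, proj_eq_add hT (fun u => h.bound (w ++ u) x) j, List.append_assoc]
  have hZ : Measurable[sigmaOn ω {u | u ≠ v}] Z := by
    refine measurable_proj_of_mem hT h.bound fun k hk => ?_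
    simpa [length_curtail] using congrArg List.length hk
  have hZ' : Measurable Z := hZ.mono (sigmaOn_le h.meas _) le_rfl
  have hindep : IndepFun (ω v) Z P :=
    indepFun_of_sigmaOn h.meas h.indep (S := {v}) (S' := {u | u ≠ v})
      (Set.disjoint_left.2 fun _ hu hu' => hu' hu) (measurable_sigmaOn ω rfl) hZ
  have hadd : Measurable fun p : Esp N × Esp N => p.1 + T (j 0) p.2 :=
    measurable_fst.add ((T (j 0)).measurable.comp measurable_snd)
  have hlaw : P ((fun x => ω v x + T (j 0) (Z x)) ⁻¹' A) =
      ((P.map (ω v)).prod (P.map Z)) ((fun p => p.1 + T (j 0) p.2) ⁻¹' A) := by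
    rw [← (indepFun_iff_map_prod_eq_prod_map_map (h.meas v).aemeasurable hZ'.aemeasurable).1 hindep,
      Measure.map_apply ((h.meas v).prodMk hZ') (hadd hA)]
    rfl
  have : IsProbabilityMeasure (P.map Z) := Measure.isProbabilityMeasure_map hZ'.aemeasurable
  rw [hsplit, hlaw]
  refine prod_preimage_add_le_of_le_smul_add (T (j 0)).measurable (hd (j 0)) (hκ v)
    (fun B hB => ?_) hA
  rw [Measure.map_apply hZ' hB]
  exact hle v _ B hB

theorem exists_measure_proj_preimage_le [IsProbabilityMeasure P] (h : IsBoundedIID P ω R)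
    (hTinj : ∀ i, Function.Injective (T i)) (hT : ∀ i, ‖T i‖ < 1) :
    ∃ K : ℝ≥0, ∀ (w : List (Fin m)) (j : CodeSpace m) (A : Set (Esp N)), MeasurableSet A →
      P ((fun x => proj T (fun u => ω (w ++ u) x) j) ⁻¹' A) ≤ K * volume A := by
  obtain ⟨d, hd, hdet⟩ := exists_volume_preimage_le hTinj
  obtain ⟨η, hη, hη_half, hηd⟩ := exists_pos_le_half_mul_le_half hd
  have : IsProbabilityMeasure (P.map (ω [])) :=
    Measure.isProbabilityMeasure_map (h.meas []).aemeasurable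
  obtain ⟨K, κ, hκη, hK⟩ := exists_le_smul_add (P.map (ω [])) volume (h.ac []) hη
  have : IsFiniteMeasure κ := ⟨(hκη.trans hη_half).trans_lt (by simp)⟩
  have hκ : ∀ w, P.map (ω w) ≤ (K : ℝ≥0∞) • volume + κ := fun w => (h.ident w []).map_eq ▸ hK
  have hpow : ∀ (n : ℕ) (w : List (Fin m)) (j : CodeSpace m) (A : Set (Esp N)), MeasurableSet A →
      P ((fun x => proj T (fun u => ω (w ++ u) x) j) ⁻¹' A) ≤ (2 * K) * volume A + 2⁻¹ ^ n := by
    intro n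
    induction n with
    | zero => exact fun w j A _ => prob_le_one.trans (by simp)
    | succ n ih =>
      intro w j A hA
      refine (measure_proj_preimage_le_of_forall h hT hdet hκ ih w j hA).trans ?_
      rw [pow_succ']
      gcongr
      · calc (K : ℝ≥0∞) + κ Set.univ * d * (2 * K) ≤ K + 2⁻¹ * (2 * K) := by
              gcongr
              exact le_trans (by gcongr) hηd
          _ = 2 * K := by
              rw [← mul_assoc, ENNReal.inv_mul_cancel (by simp) (by simp), one_mul, two_mul]
      · exact hκη.trans hη_half
  refine ⟨2 * K, fun w j A hA => ?_⟩
  have hlim : Tendsto (fun n : ℕ => (2 * K : ℝ≥0∞) * volume A + 2⁻¹ ^ n) atTop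
      (𝓝 ((2 * K : ℝ≥0∞) * volume A + 0)) :=
    (ENNReal.tendsto_pow_atTop_nhds_zero_of_lt_one (by simp)).const_add _
  simpa using ge_of_tendsto' hlim fun n => hpow n w j A hA

end BoundedDensity

/-! ### Expected moment sums -/

theorem exists_lintegral_sum_rpow_le (ι : Type*) [Fintype ι] {Ω : Type*} [MeasurableSpace Ω]
    (P : Measure Ω) {q : ℝ} (hq : 1 < q) {δ : ℝ≥0} (hδ : 0 < δ) :
    ∃ C : ℝ≥0, ∀ z : ℝ≥0∞, z ≠ 0 → z ≠ ∞ → ∀ Y : ι → Ω → ℝ≥0∞, (∀ a, Measurable (Y a)) →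
      (∀ a x, Y a x ≠ ∞) →
      (∀ a b, a ≠ b → ∫⁻ x, Y a x ^ q * Y b x ∂P ≤ z * ∫⁻ x, Y a x ^ q ∂P) →
      ∫⁻ x, (∑ a, Y a x) ^ q ∂P ≤
        (1 + δ * (1 + Fintype.card ι)) * ∑ a, ∫⁻ x, Y a x ^ q ∂P +
          C * z ^ (q - 1) * ∑ a, ∫⁻ x, Y a x ∂P := by
  classical
  obtain ⟨C, hC⟩ := exists_ennreal_sum_rpow_le ι hq hδ
  refine ⟨C, fun z hz hz_top Y hY hY_top hcross => ?_⟩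
  have hpow : ∀ a, Measurable fun x => Y a x ^ q := fun a => (hY a).pow_const q
  have hprod : ∀ a b, Measurable fun x => Y a x ^ q * Y b x / z := fun a b =>
    ((hpow a).mul (hY b)).div_const z
  have hcross_div : ∀ a, ∑ b ∈ Finset.univ.erase a, ∫⁻ x, Y a x ^ q * Y b x / z ∂P ≤
      Fintype.card ι * ∫⁻ x, Y a x ^ q ∂P := fun a => by
    calc _ ≤ ∑ _ ∈ Finset.univ.erase a, ∫⁻ x, Y a x ^ q ∂P := by
          refine Finset.sum_le_sum fun b hb => ?_
          simp only [div_eq_mul_inv]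
          rw [lintegral_mul_const _ (by fun_prop), ← div_eq_mul_inv,
            ENNReal.div_le_iff hz hz_top, mul_comm]
          exact hcross a b (Finset.ne_of_mem_erase hb).symm
      _ ≤ ∑ _ : ι, ∫⁻ x, Y a x ^ q ∂P := Finset.sum_le_sum_of_subset (Finset.erase_subset _ _)
      _ = _ := by simp
  calc ∫⁻ x, (∑ a, Y a x) ^ q ∂P
      ≤ ∫⁻ x, ((1 + δ) * ∑ a, Y a x ^ q + δ * ∑ a, ∑ b ∈ Finset.univ.erase a,
          Y a x ^ q * Y b x / z + C * z ^ (q - 1) * ∑ a, Y a x) ∂P :=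
        lintegral_mono fun x => hC z hz hz_top _ fun a => hY_top a x
    _ = (1 + δ) * ∑ a, ∫⁻ x, Y a x ^ q ∂P + δ * ∑ a, ∑ b ∈ Finset.univ.erase a,
          ∫⁻ x, Y a x ^ q * Y b x / z ∂P + C * z ^ (q - 1) * ∑ a, ∫⁻ x, Y a x ∂P := by
        rw [lintegral_add_right _ (by fun_prop), lintegral_add_right _ (by fun_prop),
          lintegral_const_mul _ (by fun_prop), lintegral_const_mul _ (by fun_prop),
          lintegral_const_mul _ (by fun_prop), lintegral_finsetSum _ (by fun_prop),
          lintegral_finsetSum _ (by fun_prop), lintegral_finsetSum _ (by fun_prop)]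
        congr! 4 with a
        exact lintegral_finsetSum _ fun b _ => hprod a b
    _ ≤ (1 + δ) * ∑ a, ∫⁻ x, Y a x ^ q ∂P + δ * ∑ a, Fintype.card ι * ∫⁻ x, Y a x ^ q ∂P +
          C * z ^ (q - 1) * ∑ a, ∫⁻ x, Y a x ∂P := by
        gcongr with a
        exact hcross_div a
    _ = _ := by
        rw [← Finset.mul_sum]
        ring

section Expectation

variable {m N : ℕ} {Ω : Type*} [MeasurableSpace Ω] {P : Measure Ω}
  {ω : List (Fin m) → Ω → Esp N} {R : ℝ} {T : Fin m → Esp N →L[ℝ] Esp N}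

/-- The expected moment sum of the projection of `μ`; with `μ` restricted to a cylinder it is the
expected contribution of that cylinder. -/
def expectedMomentSum (P : Measure Ω) (ω : List (Fin m) → Ω → Esp N)
    (T : Fin m → Esp N →L[ℝ] Esp N) (μ : Measure (CodeSpace m)) (q r : ℝ) : ℝ≥0∞ :=
  ∫⁻ x, momentSum (projMeasure T μ fun w => ω w x) q r ∂P

instance isFiniteMeasure_projMeasure (μ : Measure (CodeSpace m)) [IsFiniteMeasure μ]
    (ω : List (Fin m) → Esp N) : IsFiniteMeasure (projMeasure T μ ω) :=
  inferInstanceAs (IsFiniteMeasure (μ.map (proj T ω)))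

theorem projMeasure_univ (hT : ∀ i, ‖T i‖ < 1) {ω : List (Fin m) → Esp N} (hω : ∀ w, ‖ω w‖ ≤ R)
    (μ : Measure (CodeSpace m)) : projMeasure T μ ω Set.univ = μ Set.univ := by
  rw [projMeasure, Measure.map_apply (measurable_proj_apply hT hω) MeasurableSet.univ,
    Set.preimage_univ]

theorem projMeasure_restrict_wordCylinder_eq_sum (hT : ∀ i, ‖T i‖ < 1)
    {ω : List (Fin m) → Esp N} (hω : ∀ w, ‖ω w‖ ≤ R) (μ : Measure (CodeSpace m))
    (w : List (Fin m)) {C : Set (Esp N)} (hC : MeasurableSet C) :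
    projMeasure T (μ.restrict (wordCylinder w)) ω C =
      ∑ a, projMeasure T (μ.restrict (wordCylinder (w ++ [a]))) ω C := by
  simp only [projMeasure, Measure.map_apply (measurable_proj_apply hT hω) hC]
  rw [restrict_wordCylinder_eq_sum, Measure.finsetSum_apply]

theorem expectedMomentSum_eq_tsum (h : IsBoundedIID P ω R) (hT : ∀ i, ‖T i‖ < 1)
    (μ : Measure (CodeSpace m)) [SFinite μ] (q r : ℝ) :
    expectedMomentSum P ω T μ q r =
      ∑' l, ∫⁻ x, projMeasure T μ (fun w => ω w x) (meshCube r l) ^ q ∂P :=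
  lintegral_tsum fun l => ((measurable_projMeasure_apply hT h.meas h.bound μ
    (measurableSet_meshCube r l)).pow_const q).aemeasurable

theorem tsum_lintegral_projMeasure [IsProbabilityMeasure P] (h : IsBoundedIID P ω R)
    (hT : ∀ i, ‖T i‖ < 1) (μ : Measure (CodeSpace m)) [SFinite μ] {r : ℝ} (hr : 0 < r) :
    ∑' l, ∫⁻ x, projMeasure T μ (fun w => ω w x) (meshCube r l) ∂P = μ Set.univ := by
  rw [← lintegral_tsum fun l => (measurable_projMeasure_apply hT h.meas h.bound μ
    (measurableSet_meshCube r l)).aemeasurable]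
  simp only [tsum_measure_meshCube _ hr, projMeasure_univ hT fun w => h.bound w _]
  simp

theorem expectedMomentSum_le_rpow [IsProbabilityMeasure P] (h : IsBoundedIID P ω R)
    (hT : ∀ i, ‖T i‖ < 1) (μ : Measure (CodeSpace m)) {q : ℝ} (hq : 1 ≤ q) {r : ℝ} (hr : 0 < r) :
    expectedMomentSum P ω T μ q r ≤ μ Set.univ ^ q := by
  calc expectedMomentSum P ω T μ q r ≤ ∫⁻ _, μ Set.univ ^ q ∂P := lintegral_mono fun x =>
        (momentSum_le_rpow _ hq hr).trans_eq (by rw [projMeasure_univ hT fun w => h.bound w x])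
    _ = _ := by simp

theorem exists_measure_mem_meshCube_le [IsProbabilityMeasure P] (hN : 0 < N)
    (h : IsBoundedIID P ω R) (hTinj : ∀ i, Function.Injective (T i)) (hT : ∀ i, ‖T i‖ < 1)
    {s : ℝ≥0} (hs : (s : ℝ) ≤ N) :
    ∃ c : ℝ, 0 < c ∧ ∀ (w : List (Fin m)) (j : CodeSpace m) (r : ℝ), 0 < r →
      ∀ (l : Fin N → ℤ) (a : Esp N),
        P {x | a + wordMap T w (proj T (fun u => ω (w ++ u) x) j) ∈ meshCube r l} ≤
          ENNReal.ofReal (c * (r ^ (s : ℝ) / singularValueFunction s (wordMap T w))) := by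
  obtain ⟨K, hK⟩ := exists_measure_proj_preimage_le h hTinj hT
  set R' : ℝ := max 1 (R * (1 - (contractionRatio T : ℝ))⁻¹)
  have hR' : 1 ≤ R' := le_max_left _ _
  refine ⟨(K + 1) * ((4 * R') ^ N * (N : ℝ) ^ (s : ℝ)), by positivity, fun w j r hr l a => ?_⟩
  set A : Set (Esp N) := Metric.closedBall 0 R' ∩ (fun z => a + wordMap T w z) ⁻¹' meshCube r l
  have hA : MeasurableSet A := Metric.isClosed_closedBall.measurableSet.inter
    (((wordMap T w).measurable.const_add a) (measurableSet_meshCube r l))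
  have hvol := volume_le_of_norm_image_sub_le hN hs (wordMap_injective hTinj w) hR'
    (r := N * r) (by positivity) (A := A) (fun z hz => by simpa using hz.1)
    fun z hz z' hz' => by simpa using norm_sub_le_of_mem_meshCube hr hz.2 hz'.2
  calc P {x | a + wordMap T w (proj T (fun u => ω (w ++ u) x) j) ∈ meshCube r l}
      ≤ P ((fun x => proj T (fun u => ω (w ++ u) x) j) ⁻¹' A) := by
        refine measure_mono fun x hx => ⟨?_, hx⟩
        rw [mem_closedBall_zero_iff]
        exact (norm_proj_le hT (fun u => h.bound _ x) j).trans (le_max_right _ _)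
    _ ≤ K * volume A := hK w j A hA
    _ ≤ ENNReal.ofReal (K + 1) * ENNReal.ofReal ((4 * R') ^ N *
          ((N * r) ^ (s : ℝ) / singularValueFunction s (wordMap T w))) := by
        gcongr
        rw [← ENNReal.ofReal_coe_nnreal]
        exact ENNReal.ofReal_le_ofReal (by linarith)
    _ = _ := by
        rw [← ENNReal.ofReal_mul (by positivity), Real.mul_rpow (by positivity) hr.le]
        congr 1
        ring

theorem lintegral_mul_indicator_le_of_indepFun [IsFiniteMeasure P] {E : Type*} [MeasurableSpace E]
    {g : Ω → ℝ≥0∞} {A Z : Ω → E} (hg : Measurable g) (hA : Measurable A) (hZ : Measurable Z)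
    (hindep : IndepFun (fun x => (g x, A x)) Z P) {C : Set (E × E)} (hC : MeasurableSet C)
    {c : ℝ≥0∞} (hc : ∀ a, P {x | (a, Z x) ∈ C} ≤ c) :
    ∫⁻ x, g x * C.indicator 1 (A x, Z x) ∂P ≤ c * ∫⁻ x, g x ∂P := by
  have hF : Measurable fun p : (ℝ≥0∞ × E) × E => p.1.1 * C.indicator 1 (p.1.2, p.2) :=
    (measurable_fst.comp measurable_fst).mul ((measurable_one.indicator hC).comp
      ((measurable_snd.comp measurable_fst).prodMk measurable_snd))
  rw [lintegral_of_indepFun (hg.prodMk hA) hZ hindep hF, ← lintegral_const_mul _ hg]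
  refine lintegral_mono fun x => ?_
  have hset : MeasurableSet {y | (A x, Z y) ∈ C} := (measurable_const.prodMk hZ) hC
  calc ∫⁻ y, g x * C.indicator 1 (A x, Z y) ∂P
      = g x * ∫⁻ y, {y | (A x, Z y) ∈ C}.indicator 1 y ∂P :=
        lintegral_const_mul _ (measurable_one.indicator hset)
    _ = g x * P {y | (A x, Z y) ∈ C} := by rw [lintegral_indicator_one hset]
    _ ≤ c * g x := by
        rw [mul_comm]
        gcongr
        exact hc _

/-- The projection of a word below `w ++ [b]` is the sum of a term that depends only on the
prefixes of `w` and of `wordMap T w` applied to a term that depends only on extensions of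
`w ++ [b]`. -/
theorem lintegral_mul_indicator_proj_le [IsFiniteMeasure P] (h : IsBoundedIID P ω R)
    (hT : ∀ i, ‖T i‖ < 1) {w : List (Fin m)} {b : Fin m} {C : Set (Esp N)} (hC : MeasurableSet C)
    {c : ℝ≥0∞} (hc : ∀ j a, P {x | a + wordMap T w (proj T (fun u => ω (w ++ u) x) j) ∈ C} ≤ c)
    {g : Ω → ℝ≥0∞} (hg : Measurable[sigmaOn ω {u | ¬ w ++ [b] <+: u}] g) {j : CodeSpace m}
    (hj : j ∈ wordCylinder (w ++ [b])) :
    ∫⁻ x, g x * C.indicator 1 (proj T (fun u => ω u x) j) ∂P ≤ c * ∫⁻ x, g x ∂P := by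
  have hjw : curtail j w.length = w := wordCylinder_append_subset w b hj
  have hjb : curtail j (w.length + 1) = w ++ [b] := by
    rw [curtail_succ, hjw, (mem_wordCylinder_append.1 hj).2]
  set A : Ω → Esp N := fun x => ∑ l ∈ Finset.range w.length,
    wordMap T (curtail j l) (ω (curtail j (l + 1)) x)
  set Z : Ω → Esp N := fun x => proj T (fun u => ω (w ++ u) x) (dropFirst w.length j)
  have hdecomp : ∀ x, proj T (fun u => ω u x) j = A x + wordMap T w (Z x) := fun x => by
    rw [proj_eq_sum_add hT (fun u => h.bound u x) j w.length, hjw]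
  have hA : Measurable[sigmaOn ω {u | ¬ w ++ [b] <+: u}] A := by
    refine @Finset.measurable_fun_sum _ _ _ _ _ _ (sigmaOn ω {u | ¬ w ++ [b] <+: u}) _ _
      fun l hl => (wordMap T (curtail j l)).measurable.comp (measurable_sigmaOn ω fun hpre => ?_)
    have hlen := hpre.length_le
    rw [length_curtail, List.length_append, List.length_singleton] at hlen
    have := Finset.mem_range.1 hl
    omega
  have hZ : Measurable[sigmaOn ω {u | w ++ [b] <+: u}] Z := by
    refine measurable_proj_of_mem hT h.bound fun k => ⟨curtail (dropFirst (w.length + 1) j) k, ?_⟩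
    calc w ++ [b] ++ curtail (dropFirst (w.length + 1) j) k = curtail j (w.length + (k + 1)) := by
          rw [add_comm k 1, ← add_assoc, curtail_add, hjb]
      _ = _ := by rw [curtail_add, hjw]
  have hindep : IndepFun (fun x => (g x, A x)) Z P :=
    indepFun_of_sigmaOn h.meas h.indep (S := {u | ¬ w ++ [b] <+: u}) (S' := {u | w ++ [b] <+: u})
      (Set.disjoint_left.2 fun _ hu hu' => hu hu') (hg.prodMk hA) hZ
  have hadd : Measurable fun p : Esp N × Esp N => p.1 + wordMap T w p.2 :=
    measurable_fst.add ((wordMap T w).measurable.comp measurable_snd)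
  have hle := lintegral_mul_indicator_le_of_indepFun (hg.mono (sigmaOn_le h.meas _) le_rfl)
    (hA.mono (sigmaOn_le h.meas _) le_rfl) (hZ.mono (sigmaOn_le h.meas _) le_rfl) hindep
    (hadd hC) (hc _)
  simp only [hdecomp]
  exact hle

theorem lintegral_mul_projMeasure_restrict_le [IsFiniteMeasure P] (h : IsBoundedIID P ω R)
    (hT : ∀ i, ‖T i‖ < 1) (μ : Measure (CodeSpace m)) [SFinite μ] {w : List (Fin m)} {b : Fin m}
    {C : Set (Esp N)} (hC : MeasurableSet C) {c : ℝ≥0∞}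
    (hc : ∀ j a, P {x | a + wordMap T w (proj T (fun u => ω (w ++ u) x) j) ∈ C} ≤ c)
    {g : Ω → ℝ≥0∞} (hg : Measurable[sigmaOn ω {u | ¬ w ++ [b] <+: u}] g) :
    ∫⁻ x, g x * projMeasure T (μ.restrict (wordCylinder (w ++ [b]))) (fun u => ω u x) C ∂P ≤
      c * μ (wordCylinder (w ++ [b])) * ∫⁻ x, g x ∂P := by
  have hgm : Measurable g := hg.mono (sigmaOn_le h.meas _) le_rfl
  have hjoint : Measurable fun p : Ω × CodeSpace m =>
      g p.1 * C.indicator 1 (proj T (fun u => ω u p.1) p.2) :=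
    (hgm.comp measurable_fst).mul
      ((measurable_one.indicator hC).comp (measurable_proj hT h.bound h.meas))
  have hproj : ∀ x, g x * projMeasure T (μ.restrict (wordCylinder (w ++ [b]))) (fun u => ω u x) C =
      ∫⁻ j in wordCylinder (w ++ [b]), g x * C.indicator 1 (proj T (fun u => ω u x) j) ∂μ := by
    intro x
    have hpx := measurable_proj_apply hT fun u => h.bound u x
    rw [projMeasure, ← lintegral_indicator_one hC, lintegral_map (measurable_one.indicator hC) hpx]
    exact (lintegral_const_mul _ ((measurable_one.indicator hC).comp hpx)).symm
  simp only [hproj]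
  rw [lintegral_lintegral_swap hjoint.aemeasurable]
  calc ∫⁻ j in wordCylinder (w ++ [b]),
        ∫⁻ x, g x * C.indicator 1 (proj T (fun u => ω u x) j) ∂P ∂μ
      ≤ ∫⁻ _ in wordCylinder (w ++ [b]), c * ∫⁻ x, g x ∂P ∂μ :=
        setLIntegral_mono' (measurableSet_wordCylinder _)
          fun _ hj => lintegral_mul_indicator_proj_le h hT hC hc hg hj
    _ = _ := by rw [setLIntegral_const]; ring

theorem lintegral_rpow_mul_projMeasure_restrict_le [IsFiniteMeasure P] (h : IsBoundedIID P ω R)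
    (hT : ∀ i, ‖T i‖ < 1) (μ : Measure (CodeSpace m)) [SFinite μ] {w : List (Fin m)} {a b : Fin m}
    (hab : a ≠ b) {C : Set (Esp N)} (hC : MeasurableSet C) {c : ℝ≥0∞}
    (hc : ∀ j a, P {x | a + wordMap T w (proj T (fun u => ω (w ++ u) x) j) ∈ C} ≤ c) (q : ℝ) :
    ∫⁻ x, projMeasure T (μ.restrict (wordCylinder (w ++ [a]))) (fun u => ω u x) C ^ q *
        projMeasure T (μ.restrict (wordCylinder (w ++ [b]))) (fun u => ω u x) C ∂P ≤
      c * μ (wordCylinder w) *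
        ∫⁻ x, projMeasure T (μ.restrict (wordCylinder (w ++ [a]))) (fun u => ω u x) C ^ q ∂P := by
  have hmem : ∀ᵐ j ∂μ.restrict (wordCylinder (w ++ [a])), ∀ k,
      curtail j (k + 1) ∈ {u | ¬ w ++ [b] <+: u} := by
    filter_upwards [ae_restrict_mem (measurableSet_wordCylinder _)] with j hj k hpre
    exact hab ((mem_wordCylinder_append.1 hj).2.symm.trans
      (mem_wordCylinder_append.1 (mem_wordCylinder_of_isPrefix_curtail hpre)).2)
  have hg := (measurable_projMeasure_apply_of_mem hT h.bound _ hmem hC).pow_const q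
  refine (lintegral_mul_projMeasure_restrict_le h hT μ hC hc hg).trans ?_
  gcongr
  exact wordCylinder_append_subset w b

theorem exists_expectedMomentSum_le_sum_of_hit [IsProbabilityMeasure P] (h : IsBoundedIID P ω R)
    (hT : ∀ i, ‖T i‖ < 1) (μ : Measure (CodeSpace m)) [IsFiniteMeasure μ] {q : ℝ} (hq : 1 < q)
    {δ : ℝ≥0} (hδ : 0 < δ) :
    ∃ C : ℝ≥0, ∀ (p : ℝ≥0∞) (r : ℝ) (w : List (Fin m)), p ≠ 0 → p ≠ ∞ → 0 < r →
      (∀ l j a, P {x | a + wordMap T w (proj T (fun u => ω (w ++ u) x) j) ∈ meshCube r l} ≤ p) →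
      expectedMomentSum P ω T (μ.restrict (wordCylinder w)) q r ≤
        (1 + δ * (1 + m)) *
            ∑ a, expectedMomentSum P ω T (μ.restrict (wordCylinder (w ++ [a]))) q r +
          C * ((p * μ (wordCylinder w)) ^ (q - 1) * μ (wordCylinder w)) := by
  obtain ⟨C, hC⟩ := exists_lintegral_sum_rpow_le (Fin m) P hq hδ
  refine ⟨C, fun p r w hp hp_top hr hhit => ?_⟩
  rcases eq_or_ne (μ (wordCylinder w)) 0 with hμ | hμ
  · refine (expectedMomentSum_le_rpow h hT _ hq.le hr).trans ?_
    rw [Measure.restrict_apply_univ, hμ, ENNReal.zero_rpow_of_pos (by linarith)]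
    exact zero_le
  set z : ℝ≥0∞ := p * μ (wordCylinder w)
  set Y : List (Fin m) → (Fin N → ℤ) → Ω → ℝ≥0∞ := fun v l x =>
    projMeasure T (μ.restrict (wordCylinder v)) (fun u => ω u x) (meshCube r l)
  have hcube : ∀ l, ∫⁻ x, Y w l x ^ q ∂P ≤
      (1 + δ * (1 + m)) * ∑ a, ∫⁻ x, Y (w ++ [a]) l x ^ q ∂P +
        C * z ^ (q - 1) * ∑ a, ∫⁻ x, Y (w ++ [a]) l x ∂P := fun l => by
    have hle := hC z (mul_ne_zero hp hμ) (ENNReal.mul_ne_top hp_top (measure_ne_top _ _))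
      (fun a => Y (w ++ [a]) l)
      (fun a => measurable_projMeasure_apply hT h.meas h.bound _ (measurableSet_meshCube r l))
      (fun a x => measure_ne_top _ _) fun a b hab =>
        lintegral_rpow_mul_projMeasure_restrict_le h hT μ hab (measurableSet_meshCube r l)
          (hhit l) q
    simpa only [Y, Fintype.card_fin, ← projMeasure_restrict_wordCylinder_eq_sum hT
      (fun u => h.bound u _) μ w (measurableSet_meshCube r l)] using hle
  have hfirst : ∑' l, ∑ a, ∫⁻ x, Y (w ++ [a]) l x ∂P = μ (wordCylinder w) := by
    rw [measure_wordCylinder_eq_sum, Summable.tsum_finsetSum fun a _ => ENNReal.summable]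
    simp only [Y, tsum_lintegral_projMeasure h hT _ hr, Measure.restrict_apply_univ]
  simp only [expectedMomentSum_eq_tsum h hT]
  calc ∑' l, ∫⁻ x, Y w l x ^ q ∂P
      ≤ ∑' l, ((1 + δ * (1 + m)) * ∑ a, ∫⁻ x, Y (w ++ [a]) l x ^ q ∂P +
        C * z ^ (q - 1) * ∑ a, ∫⁻ x, Y (w ++ [a]) l x ∂P) := ENNReal.tsum_le_tsum hcube
    _ = _ := by
        rw [ENNReal.tsum_add, ENNReal.tsum_mul_left, ENNReal.tsum_mul_left, hfirst,
          Summable.tsum_finsetSum fun a _ => ENNReal.summable, mul_assoc (C : ℝ≥0∞)]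

theorem mul_rpow_sub_one_mul_self {q : ℝ} (hq : 1 < q) {c φ : ℝ} (hc : 0 ≤ c) (hφ : 0 < φ)
    (t : ℝ) (y : ℝ≥0∞) :
    (ENNReal.ofReal (c * (t / φ)) * y) ^ (q - 1) * y =
      ENNReal.ofReal c ^ (q - 1) * ENNReal.ofReal t ^ (q - 1) *
        (ENNReal.ofReal φ ^ (1 - q) * y ^ q) := by
  have hq1 : 0 ≤ q - 1 := by linarith
  rw [ENNReal.ofReal_mul hc, ENNReal.ofReal_div_of_pos hφ, div_eq_mul_inv,
    ENNReal.mul_rpow_of_nonneg _ _ hq1, ENNReal.mul_rpow_of_nonneg _ _ hq1,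
    ENNReal.mul_rpow_of_nonneg _ _ hq1, ENNReal.inv_rpow, ← ENNReal.rpow_neg, neg_sub,
    ennreal_rpow_eq_mul_rpow_sub_one hq.le y]
  ring

/-- The contribution of the word `w` to `momentSeries`. -/
def momentTerm (T : Fin m → Esp N →L[ℝ] Esp N) (μ : Measure (CodeSpace m)) (q : ℝ) (s : ℝ≥0)
    (w : List (Fin m)) : ℝ≥0∞ :=
  ENNReal.ofReal (singularValueFunction s (wordMap T w)) ^ (1 - q) * μ (wordCylinder w) ^ q

/-- Distinct subcylinders of `w` rarely hit the same cube, so the expected moment sum is almost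
additive over them. -/
theorem exists_expectedMomentSum_le_sum [IsProbabilityMeasure P] (hN : 0 < N)
    (h : IsBoundedIID P ω R) (hTinj : ∀ i, Function.Injective (T i)) (hT : ∀ i, ‖T i‖ < 1)
    (μ : Measure (CodeSpace m)) [IsFiniteMeasure μ] {q : ℝ} (hq : 1 < q) {s : ℝ≥0}
    (hs : (s : ℝ) ≤ N) {δ : ℝ≥0} (hδ : 0 < δ) :
    ∃ C : ℝ≥0∞, C ≠ ∞ ∧ ∀ r : ℝ, 0 < r → ∀ w : List (Fin m),
      expectedMomentSum P ω T (μ.restrict (wordCylinder w)) q r ≤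
        (1 + δ * (1 + m)) *
            ∑ a, expectedMomentSum P ω T (μ.restrict (wordCylinder (w ++ [a]))) q r +
          C * ENNReal.ofReal (r ^ (s : ℝ)) ^ (q - 1) * momentTerm T μ q s w := by
  obtain ⟨C, hC⟩ := exists_expectedMomentSum_le_sum_of_hit h hT μ hq hδ
  obtain ⟨c, hc, hhit⟩ := exists_measure_mem_meshCube_le hN h hTinj hT hs
  refine ⟨C * ENNReal.ofReal c ^ (q - 1), ENNReal.mul_ne_top (by simp)
    (ENNReal.rpow_ne_top_of_nonneg (by linarith) (by simp)), fun r hr w => ?_⟩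
  have hφ := singularValueFunction_pos hN s (wordMap_injective hTinj w)
  refine (hC _ r w (ENNReal.ofReal_pos.2 (by positivity)).ne' ENNReal.ofReal_ne_top hr
    fun l j => hhit w j r hr l).trans_eq ?_
  rw [mul_rpow_sub_one_mul_self hq hc.le hφ, momentTerm]
  ring

end Expectation

/-! ### The lower bound -/

section Recursion

variable {m : ℕ} {Q B B' : List (Fin m) → ℝ≥0∞} {c D E : ℝ≥0∞}

theorem le_sum_of_recursion (h : ∀ w, Q w ≤ c * ∑ a, Q (w ++ [a]) + B w) (n : ℕ) :
    Q [] ≤ ∑ k ∈ Finset.range n, c ^ k * ∑ i : Fin k → Fin m, B (List.ofFn i) +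
      c ^ n * ∑ i : Fin n → Fin m, Q (List.ofFn i) := by
  induction n with
  | zero => simp
  | succ n ih =>
    refine ih.trans ?_
    rw [Finset.sum_range_succ, sum_ofFn_succ Q, add_assoc]
    gcongr
    calc c ^ n * ∑ i : Fin n → Fin m, Q (List.ofFn i)
        ≤ c ^ n * ∑ i : Fin n → Fin m, (c * ∑ a, Q (List.ofFn i ++ [a]) + B (List.ofFn i)) := by
          gcongr
          exact h _
      _ = _ := by
          rw [Finset.sum_add_distrib, ← Finset.mul_sum]
          ring

theorem le_mul_tsum_of_recursion (h : ∀ w, Q w ≤ c * ∑ a, Q (w ++ [a]) + D * B w)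
    (hB : ∀ w, c ^ w.length * B w ≤ B' w) {n : ℕ} (hQ : ∀ w, w.length = n → Q w ≤ E * B w) :
    Q [] ≤ (D + E) * ∑' k, ∑ i : Fin k → Fin m, B' (List.ofFn i) := by
  have hlevel : ∀ k, c ^ k * ∑ i : Fin k → Fin m, B (List.ofFn i) ≤
      ∑ i : Fin k → Fin m, B' (List.ofFn i) := fun k => by
    rw [Finset.mul_sum]
    exact Finset.sum_le_sum fun i _ => by simpa using hB (List.ofFn i)
  calc Q [] ≤ ∑ k ∈ Finset.range n, c ^ k * ∑ i : Fin k → Fin m, D * B (List.ofFn i) +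
        c ^ n * ∑ i : Fin n → Fin m, Q (List.ofFn i) := le_sum_of_recursion h n
    _ ≤ ∑ k ∈ Finset.range n, c ^ k * ∑ i : Fin k → Fin m, D * B (List.ofFn i) +
        c ^ n * ∑ i : Fin n → Fin m, E * B (List.ofFn i) := by
        gcongr
        exact hQ _ List.length_ofFn
    _ = D * ∑ k ∈ Finset.range n, c ^ k * ∑ i : Fin k → Fin m, B (List.ofFn i) +
        E * (c ^ n * ∑ i : Fin n → Fin m, B (List.ofFn i)) := by
        simp only [← Finset.mul_sum, mul_left_comm]
    _ ≤ D * ∑ k ∈ Finset.range n, ∑ i : Fin k → Fin m, B' (List.ofFn i) +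
        E * ∑ i : Fin n → Fin m, B' (List.ofFn i) := by
        gcongr <;> exact hlevel _
    _ ≤ (D + E) * ∑' k, ∑ i : Fin k → Fin m, B' (List.ofFn i) := by
        rw [add_mul]
        gcongr
        · exact ENNReal.sum_le_tsum _
        · exact ENNReal.le_tsum (f := fun k => ∑ i : Fin k → Fin m, B' (List.ofFn i)) n

end Recursion

theorem ae_exists_forall_le_mul {Ω : Type*} [MeasurableSpace Ω] {P : Measure Ω}
    {f : ℕ → Ω → ℝ≥0∞} (hf : ∀ n, Measurable (f n)) {b : ℕ → ℝ≥0∞} (hb : ∀ n, b n ≠ 0)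
    (hb_top : ∀ n, b n ≠ ∞) (h : ∑' n, (∫⁻ x, f n x ∂P) / b n ≠ ∞) :
    ∀ᵐ x ∂P, ∃ A ≠ ∞, ∀ n, f n x ≤ A * b n := by
  have hmeas : ∀ n, Measurable fun x => f n x / b n := fun n => (hf n).div_const _
  have hint : ∫⁻ x, ∑' n, f n x / b n ∂P = ∑' n, (∫⁻ x, f n x ∂P) / b n := by
    rw [lintegral_tsum fun n => (hmeas n).aemeasurable]
    exact tsum_congr fun n => lintegral_mul_const (b n)⁻¹ (hf n)
  filter_upwards [ae_lt_top (Measurable.tsum hmeas) (hint.trans_ne h)] with x hx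
  exact ⟨_, hx.ne, fun n => (ENNReal.div_le_iff (hb n) (hb_top n)).1
    (ENNReal.le_tsum (f := fun n => f n x / b n) n)⟩

section LowerBound

variable {m N : ℕ} {Ω : Type*} [MeasurableSpace Ω] {P : Measure Ω}
  {ω : List (Fin m) → Ω → Esp N} {R : ℝ} {T : Fin m → Esp N →L[ℝ] Esp N}

theorem exists_singularValueFunction_wordMap_le (hN : 0 < N)
    (hTinj : ∀ i, Function.Injective (T i)) (hT : ∀ i, ‖T i‖ < 1) {s t : ℝ≥0} (hs : (s : ℝ) ≤ N)
    (hst : s < t) :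
    ∃ β : ℝ, 0 < β ∧ β < 1 ∧ ∀ w, singularValueFunction t (wordMap T w) ≤
      singularValueFunction s (wordMap T w) * β ^ w.length := by
  set α : ℝ := max (contractionRatio T) 2⁻¹
  have hα : 0 < α := lt_max_of_lt_right (by norm_num)
  have hα_one : α < 1 := max_lt (contractionRatio_lt_one hT) (by norm_num)
  have hts : 0 < (t : ℝ) - s := sub_pos.2 (NNReal.coe_lt_coe.2 hst)
  refine ⟨α ^ ((t : ℝ) - s), Real.rpow_pos_of_pos hα _, Real.rpow_lt_one hα.le hα_one hts,
    fun w => ?_⟩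
  have hinj := wordMap_injective hTinj w
  have hnorm : ‖wordMap T w‖ ≤ α ^ w.length :=
    (norm_wordMap_le w).trans (pow_le_pow_left₀ (NNReal.coe_nonneg _) (le_max_left _ _) _)
  refine (singularValueFunction_le_mul_norm_rpow hN hs hst.le hinj).trans ?_
  rw [Real.rpow_pow_comm hα.le]
  have hφ := (singularValueFunction_pos hN s hinj).le
  gcongr

theorem exists_one_lt_pow_mul_momentTerm_le (hN : 0 < N)
    (hTinj : ∀ i, Function.Injective (T i)) (hT : ∀ i, ‖T i‖ < 1) (μ : Measure (CodeSpace m))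
    {q : ℝ} (hq : 1 < q) {s t : ℝ≥0} (hs : (s : ℝ) ≤ N) (hst : s < t) :
    ∃ c : ℝ≥0, 1 < c ∧ ∀ w, (c : ℝ≥0∞) ^ w.length * momentTerm T μ q s w ≤
      momentTerm T μ q t w := by
  obtain ⟨β, hβ, hβ_one, hle⟩ := exists_singularValueFunction_wordMap_le hN hTinj hT hs hst
  refine ⟨(β ^ (1 - q)).toNNReal, Real.one_lt_toNNReal.2
    (Real.one_lt_rpow_of_pos_of_lt_one_of_neg hβ hβ_one (by linarith)), fun w => ?_⟩
  have hφ := singularValueFunction_pos hN s (wordMap_injective hTinj w)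
  have hφt := singularValueFunction_pos hN t (wordMap_injective hTinj w)
  have hpow : (β ^ (1 - q)) ^ w.length * singularValueFunction s (wordMap T w) ^ (1 - q) ≤
      singularValueFunction t (wordMap T w) ^ (1 - q) := by
    rw [Real.rpow_pow_comm hβ.le, mul_comm, ← Real.mul_rpow hφ.le (by positivity)]
    exact Real.rpow_le_rpow_of_nonpos hφt (hle w) (by linarith)
  rw [momentTerm, momentTerm, ← mul_assoc]
  gcongr
  rw [ENNReal.ofReal_rpow_of_pos hφ, ENNReal.ofReal_rpow_of_pos hφt]
  change ENNReal.ofReal _ ^ _ * _ ≤ _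
  rw [← ENNReal.ofReal_pow (by positivity), ← ENNReal.ofReal_mul (by positivity)]
  exact ENNReal.ofReal_le_ofReal hpow

theorem expectedMomentSum_restrict_le_momentTerm [IsProbabilityMeasure P] (hN : 0 < N)
    (h : IsBoundedIID P ω R) (hTinj : ∀ i, Function.Injective (T i)) (hT : ∀ i, ‖T i‖ < 1)
    (μ : Measure (CodeSpace m)) {q : ℝ} (hq : 1 ≤ q) (s : ℝ≥0) {r : ℝ} (hr : 0 < r)
    {w : List (Fin m)} (hw : ‖wordMap T w‖ ≤ r) :
    expectedMomentSum P ω T (μ.restrict (wordCylinder w)) q r ≤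
      ENNReal.ofReal (r ^ (s : ℝ)) ^ (q - 1) * momentTerm T μ q s w := by
  have hinj := wordMap_injective hTinj w
  have hφ := singularValueFunction_pos hN s hinj
  have hφr : singularValueFunction s (wordMap T w) ≤ r ^ (s : ℝ) :=
    (singularValueFunction_le_norm_rpow hN s hinj).trans (by gcongr)
  have hone : 1 ≤ ENNReal.ofReal (r ^ (s : ℝ)) ^ (q - 1) *
      ENNReal.ofReal (singularValueFunction s (wordMap T w)) ^ (1 - q) := by
    calc (1 : ℝ≥0∞) = ENNReal.ofReal (singularValueFunction s (wordMap T w)) ^ (q - 1) *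
          ENNReal.ofReal (singularValueFunction s (wordMap T w)) ^ (1 - q) := by
          rw [← ENNReal.rpow_add _ _ (by simpa using hφ) (by simp)]
          simp
      _ ≤ _ := by
          gcongr
  refine (expectedMomentSum_le_rpow h hT _ hq hr).trans ?_
  rw [Measure.restrict_apply_univ, momentTerm, ← mul_assoc]
  exact le_mul_of_one_le_left zero_le hone

theorem exists_expectedMomentSum_le [IsProbabilityMeasure P] (hN : 0 < N)
    (h : IsBoundedIID P ω R) (hTinj : ∀ i, Function.Injective (T i)) (hT : ∀ i, ‖T i‖ < 1)
    (μ : Measure (CodeSpace m)) [IsFiniteMeasure μ] {q : ℝ} (hq : 1 < q) {s t : ℝ≥0}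
    (hs : (s : ℝ) ≤ N) (hst : s < t) (ht : momentSeries T μ q t < ∞) :
    ∃ A : ℝ≥0∞, A ≠ ∞ ∧ ∀ r : ℝ, 0 < r →
      expectedMomentSum P ω T μ q r ≤ A * ENNReal.ofReal (r ^ (s : ℝ)) ^ (q - 1) := by
  obtain ⟨c, hc, hterm⟩ := exists_one_lt_pow_mul_momentTerm_le hN hTinj hT μ hq hs hst
  obtain ⟨C, hC, hrec⟩ := exists_expectedMomentSum_le_sum hN h hTinj hT μ hq hs
    (δ := (c - 1) / (1 + m)) (div_pos (tsub_pos_of_lt hc) (by positivity))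
  have hδ : (1 + ((c - 1) / (1 + m) : ℝ≥0) * (1 + m) : ℝ≥0∞) = c := by
    have : 1 + (c - 1) / (1 + m) * (1 + m) = c := by
      rw [div_mul_cancel₀ _ (by positivity), add_tsub_cancel_of_le hc.le]
    exact_mod_cast congrArg ((↑) : ℝ≥0 → ℝ≥0∞) this
  simp only [hδ] at hrec
  refine ⟨(C + 1) * momentSeries T μ q t,
    ENNReal.mul_ne_top (ENNReal.add_ne_top.2 ⟨hC, by simp⟩) ht.ne, fun r hr => ?_⟩
  obtain ⟨n, hn⟩ := exists_pow_lt_of_lt_one hr (contractionRatio_lt_one hT)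
  have hle := le_mul_tsum_of_recursion
    (Q := fun w => expectedMomentSum P ω T (μ.restrict (wordCylinder w)) q r) (hrec r hr) hterm
    fun w hw => expectedMomentSum_restrict_le_momentTerm hN h hTinj hT μ hq.le s hr
      ((norm_wordMap_le w).trans (hw ▸ hn.le))
  calc expectedMomentSum P ω T μ q r
      = expectedMomentSum P ω T (μ.restrict (wordCylinder [])) q r := by
        rw [wordCylinder_nil, Measure.restrict_univ]
    _ ≤ _ := hle
    _ = (C + 1) * momentSeries T μ q t * ENNReal.ofReal (r ^ (s : ℝ)) ^ (q - 1) := by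
        change _ * momentSeries T μ q t = _
        ring

theorem measurable_momentSum (h : IsBoundedIID P ω R) (hT : ∀ i, ‖T i‖ < 1)
    (μ : Measure (CodeSpace m)) [SFinite μ] (q r : ℝ) :
    Measurable fun x => momentSum (projMeasure T μ fun w => ω w x) q r :=
  Measurable.tsum fun l => (measurable_projMeasure_apply hT h.meas h.bound μ
    (measurableSet_meshCube r l)).pow_const q

theorem ae_le_lowerDim_of_expectedMomentSum_le (h : IsBoundedIID P ω R) (hT : ∀ i, ‖T i‖ < 1)
    (μ : Measure (CodeSpace m)) [SFinite μ] {q : ℝ} (hq : 1 < q) {s u : ℝ≥0} (hsu : s < u)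
    {A : ℝ≥0∞} (hA : A ≠ ∞)
    (hbound : ∀ r : ℝ, 0 < r →
      expectedMomentSum P ω T μ q r ≤ A * ENNReal.ofReal (r ^ (u : ℝ)) ^ (q - 1)) :
    ∀ᵐ x ∂P, ((s : ℝ) : EReal) ≤ lowerDim (projMeasure T μ fun w => ω w x) q := by
  have hus : 0 < ((u : ℝ) - s) * (q - 1) :=
    mul_pos (sub_pos.2 (NNReal.coe_lt_coe.2 hsu)) (by linarith)
  set b : ℕ → ℝ≥0∞ := fun n => ENNReal.ofReal (((1 / 2 : ℝ) ^ n) ^ ((s : ℝ) * (q - 1)))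
  have hb : ∀ n, b n ≠ 0 := fun n => (ENNReal.ofReal_pos.2 (by positivity)).ne'
  set e : ℝ≥0∞ := ENNReal.ofReal ((1 / 2 : ℝ) ^ (((u : ℝ) - s) * (q - 1)))
  have he : e < 1 :=
    ENNReal.ofReal_lt_one.2 (Real.rpow_lt_one (by norm_num) (by norm_num) hus)
  have hpow : ∀ n, ENNReal.ofReal (((1 / 2 : ℝ) ^ n) ^ (u : ℝ)) ^ (q - 1) = e ^ n * b n := by
    intro n
    rw [ENNReal.ofReal_rpow_of_pos (by positivity), ← ENNReal.ofReal_pow (by positivity),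
      ← ENNReal.ofReal_mul (by positivity), Real.rpow_pow_comm (by positivity),
      ← Real.rpow_add (by positivity), ← Real.rpow_mul (by positivity)]
    ring_nf
  have hsum : ∑' n : ℕ, expectedMomentSum P ω T μ q ((1 / 2) ^ n) / b n ≠ ∞ := by
    refine ne_top_of_le_ne_top ?_ (ENNReal.tsum_le_tsum fun n => ENNReal.div_le_of_le_mul
      ((hbound _ (by positivity)).trans_eq ((congrArg _ (hpow n)).trans (mul_assoc _ _ _).symm)))
    rw [ENNReal.tsum_mul_left, ENNReal.tsum_geometric]
    exact ENNReal.mul_ne_top hA (ENNReal.inv_ne_top.2 (tsub_pos_of_lt he).ne')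
  filter_upwards [ae_exists_forall_le_mul (fun n => measurable_momentSum h hT μ q ((1 / 2) ^ n)) hb
    (fun n => ENNReal.ofReal_ne_top) hsum] with x ⟨B, hB, hle⟩
  exact le_lowerDim_of_dyadic _ hq s.2 hB hle

theorem ae_le_lowerDim [IsProbabilityMeasure P] (hN : 0 < N)
    (h : IsBoundedIID P ω R) (hTinj : ∀ i, Function.Injective (T i)) (hT : ∀ i, ‖T i‖ < 1)
    (μ : Measure (CodeSpace m)) [IsFiniteMeasure μ] {q : ℝ} (hq : 1 < q) {s : ℝ≥0}
    (hs : (s : ℝ≥0∞) < min (dqLower T μ q) N) :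
    ∀ᵐ x ∂P, ((s : ℝ) : EReal) ≤ lowerDim (projMeasure T μ fun w => ω w x) q := by
  obtain ⟨hsd, hsN⟩ := lt_min_iff.1 hs
  simp only [dqLower, lt_iSup_iff] at hsd
  obtain ⟨t, ht, hst⟩ := hsd
  obtain ⟨u, hsu, hu⟩ := exists_between
    (lt_min (a := s) (b := t) (c := (N : ℝ≥0)) (by exact_mod_cast hst) (by exact_mod_cast hsN))
  obtain ⟨hut, huN⟩ := lt_min_iff.1 hu
  obtain ⟨A, hA, hbound⟩ := exists_expectedMomentSum_le hN h hTinj hT μ hq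
    (by exact_mod_cast huN.le) hut ht
  exact ae_le_lowerDim_of_expectedMomentSum_le h hT μ hq hsu hA hbound

end LowerBound

/-! ### The upper bound -/

section CoveringBounds

variable {N : ℕ} (τ : Measure (Esp N)) {q r R : ℝ}

theorem measure_univ_rpow_le_card_mul_momentSum (hq : 1 ≤ q) {F : Finset (Fin N → ℤ)}
    (hF : ∀ᵐ x ∂τ, x ∈ ⋃ j ∈ F, meshCube r j) :
    τ Set.univ ^ q ≤ (F.card : ℝ≥0∞) ^ (q - 1) * momentSum τ q r := by
  rw [← measure_congr (eventuallyEq_univ.2 hF)]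
  refine (measure_rpow_le_of_subset_biUnion τ hq F _ subset_rfl).trans ?_
  gcongr
  calc ∑ j ∈ F, τ (meshCube r j ∩ ⋃ j ∈ F, meshCube r j) ^ q
      ≤ ∑ j ∈ F, τ (meshCube r j) ^ q := by
        gcongr
        exact Set.inter_subset_left
    _ ≤ momentSum τ q r := ENNReal.sum_le_tsum F

theorem measure_univ_rpow_le_of_ae_mem_image (hq : 1 ≤ q) (hR : 0 ≤ R) (hr : 0 < r)
    (L : Esp N →L[ℝ] Esp N) (x₀ : Esp N)
    (hτ : ∀ᵐ x ∂τ, x ∈ (fun z => x₀ + L z) '' Metric.closedBall 0 R) :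
    τ Set.univ ^ q ≤ ENNReal.ofReal ((2 * N + 3) ^ N * (2 * R + 2) ^ N *
      ∏ i ∈ Finset.range N, max 1 (L.toLinearMap.singularValues i / r)) ^ (q - 1) *
        momentSum τ q r := by
  obtain ⟨F, hF, hcard⟩ := exists_cover_meshCube L hR hr x₀
  refine (measure_univ_rpow_le_card_mul_momentSum τ hq (r := r) (F := F) (hτ.mono ?_)).trans ?_
  · rintro _ ⟨z, hz, rfl⟩
    exact hF z (mem_closedBall_zero_iff.1 hz)
  · have : 0 ≤ q - 1 := by linarith
    gcongr
    rw [← ENNReal.ofReal_natCast]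
    exact ENNReal.ofReal_le_ofReal hcard

theorem exists_measure_univ_rpow_le (hq : 1 ≤ q) (hsupp : ∀ᵐ x ∂τ, ‖x‖ ≤ R) :
    ∃ K : ℝ, 0 < K ∧ ∀ r ∈ Set.Ioo (0 : ℝ) 1,
      τ Set.univ ^ q ≤ ENNReal.ofReal (K * (r ^ (N : ℝ))⁻¹) ^ (q - 1) * momentSum τ q r := by
  refine ⟨(2 * N + 3) ^ N * (2 * |R| + 2) ^ N, by positivity, fun r hr => ?_⟩
  have hr_pos := hr.1
  have hprod : ∏ i ∈ Finset.range N,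
      max 1 ((ContinuousLinearMap.id ℝ (Esp N)).toLinearMap.singularValues i / r) ≤
        (r ^ (N : ℝ))⁻¹ := by
    calc _ ≤ ∏ _i ∈ Finset.range N, r⁻¹ := by
          refine Finset.prod_le_prod (fun _ _ => le_max_of_le_left zero_le_one) fun i _ => ?_
          rw [inv_eq_one_div]
          refine max_le ((one_le_div hr.1).2 hr.2.le) ?_
          gcongr
          exact (singularValues_le_opNorm _ i).trans ContinuousLinearMap.norm_id_le
      _ = _ := by simp
  have hle := measure_univ_rpow_le_of_ae_mem_image τ hq (abs_nonneg R) hr.1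
    (ContinuousLinearMap.id ℝ (Esp N)) 0
    (hsupp.mono fun x hx => ⟨x, mem_closedBall_zero_iff.2 (hx.trans (le_abs_self R)), by simp⟩)
  refine hle.trans ?_
  have : 0 ≤ q - 1 := by linarith
  gcongr

theorem lowerDim_le_dim [IsFiniteMeasure τ] (hτ : τ ≠ 0) (hq : 1 < q)
    (hsupp : ∀ᵐ x ∂τ, ‖x‖ ≤ R) : lowerDim τ q ≤ ((N : ℝ) : EReal) := by
  obtain ⟨K, hK, hle⟩ := exists_measure_univ_rpow_le τ hq.le hsupp
  set M : ℝ≥0∞ := τ Set.univ ^ q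
  have hM_top : M ≠ ∞ := ENNReal.rpow_ne_top_of_nonneg (by linarith) (measure_ne_top _ _)
  have hM : 0 < M.toReal := ENNReal.toReal_pos (ENNReal.rpow_pos
    (pos_iff_ne_zero.2 (Measure.measure_univ_ne_zero.2 hτ)) (measure_ne_top _ _)).ne' hM_top
  refine lowerDim_le_of_eventually_le τ hq (c := M.toReal / K ^ (q - 1)) (by positivity) ?_
  filter_upwards [eventually_mem_Ioo_zero_one] with r hr
  have hr_pos := hr.1
  have hconst : M.toReal / K ^ (q - 1) * r ^ ((N : ℝ) * (q - 1)) =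
      M.toReal / (K * (r ^ (N : ℝ))⁻¹) ^ (q - 1) := by
    rw [Real.mul_rpow hK.le (by positivity), Real.inv_rpow (by positivity), Real.rpow_mul hr.1.le]
    field_simp
  rw [hconst, ENNReal.ofReal_div_of_pos (by positivity), ENNReal.ofReal_toReal hM_top,
    ← ENNReal.ofReal_rpow_of_pos (by positivity)]
  exact ENNReal.div_le_of_le_mul' (hle r hr)

theorem tsum_dyadic_rpow_mul_momentSum_ne_top [IsFiniteMeasure τ] (hq : 1 < q) {s : ℝ} (hs : 0 ≤ s)
    (h : (s : EReal) < lowerDim τ q) :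
    ∑' n : ℕ, ENNReal.ofReal (((1 / 2 : ℝ) ^ n) ^ (-(s * (q - 1)))) * momentSum τ q ((1 / 2) ^ n)
      ≠ ∞ := by
  obtain ⟨t, hst, ht⟩ := EReal.lt_iff_exists_real_btwn.1 h
  rw [EReal.coe_lt_coe_iff] at hst
  obtain ⟨A, hA, hle⟩ := exists_momentSum_le τ hq (hs.trans hst.le) ht
  set e : ℝ≥0∞ := ENNReal.ofReal ((1 / 2 : ℝ) ^ ((t - s) * (q - 1)))
  have he : e < 1 := ENNReal.ofReal_lt_one.2 (Real.rpow_lt_one (by norm_num) (by norm_num)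
    (mul_pos (by linarith) (by linarith)))
  have hterm : ∀ n : ℕ, ENNReal.ofReal (((1 / 2 : ℝ) ^ n) ^ (-(s * (q - 1)))) *
      momentSum τ q ((1 / 2) ^ n) ≤ A * e ^ n := by
    intro n
    calc _ ≤ ENNReal.ofReal (((1 / 2 : ℝ) ^ n) ^ (-(s * (q - 1)))) *
          (A * ENNReal.ofReal (((1 / 2 : ℝ) ^ n) ^ (t * (q - 1)))) := by
          gcongr
          exact hle _ (by positivity)
      _ = A * e ^ n := by
          rw [mul_left_comm, ← ENNReal.ofReal_mul (by positivity), ← ENNReal.ofReal_pow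
            (by positivity), Real.rpow_pow_comm (by positivity), ← Real.rpow_add (by positivity)]
          ring_nf
  refine ne_top_of_le_ne_top ?_ (ENNReal.tsum_le_tsum hterm)
  rw [ENNReal.tsum_mul_left, ENNReal.tsum_geometric]
  exact ENNReal.mul_ne_top hA (ENNReal.inv_ne_top.2 (tsub_pos_of_lt he).ne')

end CoveringBounds

section UpperBound

variable {m N : ℕ} {ω : List (Fin m) → Esp N} {R : ℝ} {T : Fin m → Esp N →L[ℝ] Esp N}

theorem proj_eq_sum_take_add (hT : ∀ i, ‖T i‖ < 1) (hω : ∀ w, ‖ω w‖ ≤ R) {w : List (Fin m)}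
    {i : CodeSpace m} (hi : i ∈ wordCylinder w) :
    proj T ω i = ∑ l ∈ Finset.range w.length, wordMap T (w.take l) (ω (w.take (l + 1))) +
      wordMap T w (proj T (fun u => ω (w ++ u)) (dropFirst w.length i)) := by
  have hw : curtail i w.length = w := hi
  rw [proj_eq_sum_add hT hω i w.length, hw]
  congr 1
  refine Finset.sum_congr rfl fun l hl => ?_
  rw [Finset.mem_range] at hl
  rw [curtail_eq_take hi hl.le, curtail_eq_take hi hl]

theorem exists_measure_wordCylinder_rpow_le (hT : ∀ i, ‖T i‖ < 1) (hω : ∀ w, ‖ω w‖ ≤ R)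
    (μ : Measure (CodeSpace m)) {q : ℝ} (hq : 1 ≤ q) :
    ∃ K : ℝ, 0 < K ∧ ∀ (w : List (Fin m)) (r : ℝ), 0 < r →
      μ (wordCylinder w) ^ q ≤ ENNReal.ofReal (K * ∏ i ∈ Finset.range N,
        max 1 ((wordMap T w).toLinearMap.singularValues i / r)) ^ (q - 1) *
          momentSum (projMeasure T (μ.restrict (wordCylinder w)) ω) q r := by
  set R' : ℝ := R * (1 - (contractionRatio T : ℝ))⁻¹
  have hR' : 0 ≤ R' := mul_nonneg ((norm_nonneg _).trans (hω []))
    (inv_nonneg.2 (sub_nonneg.2 (contractionRatio_lt_one hT).le))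
  refine ⟨(2 * N + 3) ^ N * (2 * R' + 2) ^ N, by positivity, fun w r hr => ?_⟩
  set x₀ := ∑ l ∈ Finset.range w.length, wordMap T (w.take l) (ω (w.take (l + 1)))
  have hS : MeasurableSet ((fun z => x₀ + wordMap T w z) '' Metric.closedBall 0 R') :=
    ((isCompact_closedBall 0 R').image (by fun_prop)).measurableSet
  rw [← Measure.restrict_apply_univ (μ := μ), ← projMeasure_univ hT hω]
  refine measure_univ_rpow_le_of_ae_mem_image _ hq hR' hr (wordMap T w) x₀ ?_
  refine (ae_map_iff (measurable_proj_apply hT hω).aemeasurable hS).2 ?_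
  filter_upwards [ae_restrict_mem (measurableSet_wordCylinder w)] with i hi
  exact ⟨_, mem_closedBall_zero_iff.2 (norm_proj_le hT (fun u => hω (w ++ u)) _),
    (proj_eq_sum_take_add hT hω hi).symm⟩

theorem sum_momentSum_restrict_le (hT : ∀ i, ‖T i‖ < 1) (hω : ∀ w, ‖ω w‖ ≤ R)
    (μ : Measure (CodeSpace m)) {q : ℝ} (hq : 1 ≤ q) (r : ℝ) (k : ℕ) :
    ∑ i : Fin k → Fin m, momentSum (projMeasure T (μ.restrict (wordCylinder (List.ofFn i))) ω) q r
      ≤ momentSum (projMeasure T μ ω) q r := by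
  simp only [momentSum]
  rw [← Summable.tsum_finsetSum fun i _ => ENNReal.summable]
  refine ENNReal.tsum_le_tsum fun l => ?_
  have hmeas := measurable_proj_apply hT hω (measurableSet_meshCube r l)
  have hsum : projMeasure T μ ω (meshCube r l) = ∑ i : Fin k → Fin m,
      projMeasure T (μ.restrict (wordCylinder (List.ofFn i))) ω (meshCube r l) := by
    simp only [projMeasure, Measure.map_apply (measurable_proj_apply hT hω)
      (measurableSet_meshCube r l), Measure.restrict_apply hmeas]
    simpa only [Measure.restrict_apply_univ, Measure.restrict_apply (measurableSet_wordCylinder _),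
      Set.inter_comm] using
        (sum_measure_wordCylinder (μ.restrict (proj T ω ⁻¹' meshCube r l)) k).symm
  rw [hsum]
  simpa only [tsum_fintype] using tsum_rpow_le_rpow_tsum (fun i : Fin k → Fin m =>
    projMeasure T (μ.restrict (wordCylinder (List.ofFn i))) ω (meshCube r l)) hq

theorem exists_momentTerm_le_mul_momentSum (hN : 0 < N) (hTinj : ∀ i, Function.Injective (T i))
    (hT : ∀ i, ‖T i‖ < 1) (hω : ∀ w, ‖ω w‖ ≤ R) (μ : Measure (CodeSpace m)) {q : ℝ} (hq : 1 ≤ q)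
    {s : ℝ≥0} (hs : (s : ℝ) ≤ N) :
    ∃ B : ℝ≥0∞, B ≠ ∞ ∧ ∀ (w : List (Fin m)) (r : ℝ), 0 < r →
      (wordMap T w).toLinearMap.singularValues (criticalIndex s) ≤ r →
      r ≤ 2 * (wordMap T w).toLinearMap.singularValues (criticalIndex s) →
      momentTerm T μ q s w ≤ B * (ENNReal.ofReal (r ^ (-((s : ℝ) * (q - 1)))) *
        momentSum (projMeasure T (μ.restrict (wordCylinder w)) ω) q r) := by
  obtain ⟨K, hK, hcyl⟩ := exists_measure_wordCylinder_rpow_le hT hω μ hq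
  have hq1 : 0 ≤ q - 1 := by linarith
  refine ⟨ENNReal.ofReal (K * 2 ^ N) ^ (q - 1), ENNReal.rpow_ne_top_of_nonneg hq1 (by simp),
    fun w r hr hle hge => ?_⟩
  have hinj := wordMap_injective hTinj w
  have hφ := singularValueFunction_pos hN s hinj
  set φ := singularValueFunction s (wordMap T w)
  set S := momentSum (projMeasure T (μ.restrict (wordCylinder w)) ω) q r
  have hr_rpow : ENNReal.ofReal (r ^ (-((s : ℝ) * (q - 1)))) =
      ENNReal.ofReal (r ^ (s : ℝ))⁻¹ ^ (q - 1) := by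
    rw [ENNReal.ofReal_rpow_of_pos (by positivity), Real.inv_rpow (by positivity),
      ← Real.rpow_mul hr.le, ← Real.rpow_neg hr.le]
  have hprod : K * ∏ i ∈ Finset.range N,
      max 1 ((wordMap T w).toLinearMap.singularValues i / r) ≤ φ * (K * 2 ^ N * (r ^ (s : ℝ))⁻¹) :=
    calc _ ≤ K * (2 ^ N * (φ / r ^ (s : ℝ))) := by
          gcongr
          exact prod_max_one_singularValues_div_le hN hs hinj hr hle hge
      _ = _ := by rw [div_eq_mul_inv]; ring
  calc momentTerm T μ q s w
      ≤ ENNReal.ofReal φ ^ (1 - q) *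
          (ENNReal.ofReal (φ * (K * 2 ^ N * (r ^ (s : ℝ))⁻¹)) ^ (q - 1) * S) := by
        unfold momentTerm
        gcongr
        refine (hcyl w r hr).trans ?_
        gcongr
    _ = ENNReal.ofReal φ ^ (1 - q) * ENNReal.ofReal φ ^ (q - 1) * (ENNReal.ofReal (K * 2 ^ N) ^
          (q - 1) * (ENNReal.ofReal (r ^ (s : ℝ))⁻¹ ^ (q - 1) * S)) := by
        rw [ENNReal.ofReal_mul hφ.le, ENNReal.ofReal_mul (by positivity),
          ENNReal.mul_rpow_of_nonneg _ _ hq1, ENNReal.mul_rpow_of_nonneg _ _ hq1]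
        ring
    _ = _ := by
        rw [← ENNReal.rpow_add _ _ (by simpa using hφ) (by simp), hr_rpow]
        simp

theorem exists_momentTerm_le_mul_tsum (hN : 0 < N) (hTinj : ∀ i, Function.Injective (T i))
    (hT : ∀ i, ‖T i‖ < 1) (hω : ∀ w, ‖ω w‖ ≤ R) (μ : Measure (CodeSpace m)) {q : ℝ} (hq : 1 ≤ q)
    {s : ℝ≥0} (hs : (s : ℝ) ≤ N) {u : ℝ} (hsu : s ≤ u) :
    ∃ B : ℝ≥0∞, B ≠ ∞ ∧ ∀ w : List (Fin m), momentTerm T μ q s w ≤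
      B * ENNReal.ofReal ((2 * ‖wordMap T w‖) ^ ((u - s) * (q - 1))) *
        ∑' n : ℕ, ENNReal.ofReal (((1 / 2 : ℝ) ^ n) ^ (-(u * (q - 1)))) *
          momentSum (projMeasure T (μ.restrict (wordCylinder w)) ω) q ((1 / 2) ^ n) := by
  obtain ⟨B, hB, hterm⟩ := exists_momentTerm_le_mul_momentSum hN hTinj hT hω μ hq hs
  refine ⟨B, hB, fun w => ?_⟩
  have hnorm : ‖wordMap T w‖ ≤ 1 := (norm_wordMap_le w).trans
    (pow_le_one₀ (NNReal.coe_nonneg _) (contractionRatio_lt_one hT).le)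
  have hσ_le := singularValues_le_opNorm (wordMap T w) (criticalIndex s)
  obtain ⟨n, hle, hge⟩ := exists_pow_half_mem_Icc
    (singularValues_pos (wordMap_injective hTinj w) (criticalIndex_lt hN hs)) (hσ_le.trans hnorm)
  have hr : (0 : ℝ) < (1 / 2) ^ n := by positivity
  have : 0 ≤ (u - s) * (q - 1) := mul_nonneg (by linarith) (by linarith)
  have hshift : ((1 / 2 : ℝ) ^ n) ^ (-((s : ℝ) * (q - 1))) ≤
      (2 * ‖wordMap T w‖) ^ ((u - s) * (q - 1)) * ((1 / 2 : ℝ) ^ n) ^ (-(u * (q - 1))) := by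
    calc ((1 / 2 : ℝ) ^ n) ^ (-((s : ℝ) * (q - 1)))
        = ((1 / 2 : ℝ) ^ n) ^ ((u - s) * (q - 1)) * ((1 / 2 : ℝ) ^ n) ^ (-(u * (q - 1))) := by
          rw [← Real.rpow_add hr]
          ring_nf
      _ ≤ _ := by
          gcongr
          exact hge.trans (by gcongr)
  refine (hterm w _ hr hle hge).trans ?_
  rw [mul_assoc, ← ENNReal.tsum_mul_left]
  gcongr
  refine le_trans ?_ (ENNReal.le_tsum n)
  rw [← mul_assoc, ← ENNReal.ofReal_mul (by positivity)]
  gcongr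

theorem exists_sum_momentTerm_le (hN : 0 < N) (hTinj : ∀ i, Function.Injective (T i))
    (hT : ∀ i, ‖T i‖ < 1) (hω : ∀ w, ‖ω w‖ ≤ R) (μ : Measure (CodeSpace m)) {q : ℝ} (hq : 1 ≤ q)
    {s : ℝ≥0} (hs : (s : ℝ) ≤ N) {u : ℝ} (hsu : s ≤ u) :
    ∃ B : ℝ≥0∞, B ≠ ∞ ∧ ∀ k : ℕ, ∑ i : Fin k → Fin m, momentTerm T μ q s (List.ofFn i) ≤
      B * ENNReal.ofReal ((2 * (contractionRatio T : ℝ) ^ k) ^ ((u - s) * (q - 1))) *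
        ∑' n : ℕ, ENNReal.ofReal (((1 / 2 : ℝ) ^ n) ^ (-(u * (q - 1)))) *
          momentSum (projMeasure T μ ω) q ((1 / 2) ^ n) := by
  obtain ⟨B, hB, hterm⟩ := exists_momentTerm_le_mul_tsum hN hTinj hT hω μ hq hs hsu
  refine ⟨B, hB, fun k => ?_⟩
  have : 0 ≤ (u - s) * (q - 1) := mul_nonneg (by linarith) (by linarith)
  have hnorm : ∀ i : Fin k → Fin m, ‖wordMap T (List.ofFn i)‖ ≤ (contractionRatio T : ℝ) ^ k :=
    fun i => by simpa using norm_wordMap_le (T := T) (List.ofFn i)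
  have hword : ∀ i : Fin k → Fin m, momentTerm T μ q s (List.ofFn i) ≤
      B * ENNReal.ofReal ((2 * (contractionRatio T : ℝ) ^ k) ^ ((u - s) * (q - 1))) *
        ∑' n : ℕ, ENNReal.ofReal (((1 / 2 : ℝ) ^ n) ^ (-(u * (q - 1)))) *
          momentSum (projMeasure T (μ.restrict (wordCylinder (List.ofFn i))) ω) q ((1 / 2) ^ n) :=
    fun i => (hterm (List.ofFn i)).trans (by gcongr; exact hnorm i)
  refine (Finset.sum_le_sum fun i _ => hword i).trans ?_
  rw [← Finset.mul_sum, ← Summable.tsum_finsetSum fun i _ => ENNReal.summable]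
  gcongr with n
  rw [← Finset.mul_sum]
  gcongr
  exact sum_momentSum_restrict_le hT hω μ hq _ k

theorem momentSeries_lt_top (hN : 0 < N) (hTinj : ∀ i, Function.Injective (T i))
    (hT : ∀ i, ‖T i‖ < 1) (hω : ∀ w, ‖ω w‖ ≤ R) (μ : Measure (CodeSpace m)) [IsFiniteMeasure μ]
    {q : ℝ} (hq : 1 < q) {s : ℝ≥0} (hs : (s : ℝ) ≤ N)
    (h : ((s : ℝ) : EReal) < lowerDim (projMeasure T μ ω) q) : momentSeries T μ q s < ∞ := by
  obtain ⟨u, hsu, hu⟩ := EReal.lt_iff_exists_real_btwn.1 h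
  rw [EReal.coe_lt_coe_iff] at hsu
  obtain ⟨B, hB, hlevel⟩ := exists_sum_momentTerm_le hN hTinj hT hω μ hq.le hs hsu.le
  set S := ∑' n : ℕ, ENNReal.ofReal (((1 / 2 : ℝ) ^ n) ^ (-(u * (q - 1)))) *
    momentSum (projMeasure T μ ω) q ((1 / 2) ^ n)
  have hS : S ≠ ∞ := tsum_dyadic_rpow_mul_momentSum_ne_top _ hq (s.2.trans hsu.le) hu
  set ε := (u - s) * (q - 1)
  have hε : 0 < ε := mul_pos (by linarith) (by linarith)
  set d : ℝ≥0∞ := ENNReal.ofReal ((contractionRatio T : ℝ) ^ ε)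
  have hd : d < 1 := ENNReal.ofReal_lt_one.2
    (Real.rpow_lt_one (NNReal.coe_nonneg _) (contractionRatio_lt_one hT) hε)
  have hpow : ∀ k : ℕ, ENNReal.ofReal ((2 * (contractionRatio T : ℝ) ^ k) ^ ε) =
      ENNReal.ofReal (2 ^ ε) * d ^ k := fun k => by
    rw [Real.mul_rpow zero_le_two (by positivity), ENNReal.ofReal_mul (by positivity),
      ← Real.rpow_pow_comm (NNReal.coe_nonneg _), ENNReal.ofReal_pow (by positivity)]
  refine (ENNReal.tsum_le_tsum hlevel).trans_lt ?_
  simp only [hpow]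
  rw [ENNReal.tsum_mul_right, ENNReal.tsum_mul_left, ENNReal.tsum_mul_left, ENNReal.tsum_geometric]
  have hgeom : (1 - d)⁻¹ ≠ ∞ := ENNReal.inv_ne_top.2 (tsub_pos_of_lt hd).ne'
  finiteness

theorem lowerDim_projMeasure_le_dim (hT : ∀ i, ‖T i‖ < 1) (hω : ∀ w, ‖ω w‖ ≤ R)
    (μ : Measure (CodeSpace m)) [IsFiniteMeasure μ] (hμ : μ ≠ 0) {q : ℝ} (hq : 1 < q) :
    lowerDim (projMeasure T μ ω) q ≤ ((N : ℝ) : EReal) := by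
  have hproj := measurable_proj_apply hT hω
  refine lowerDim_le_dim _ ((Measure.map_ne_zero_iff hproj.aemeasurable).2 hμ) hq
    ((ae_map_iff hproj.aemeasurable (measurableSet_le measurable_norm measurable_const)).2
      (ae_of_all μ (norm_proj_le hT hω)))

theorem lowerDim_le_min (hN : 0 < N) (hTinj : ∀ i, Function.Injective (T i))
    (hT : ∀ i, ‖T i‖ < 1) (hω : ∀ w, ‖ω w‖ ≤ R) (μ : Measure (CodeSpace m)) [IsFiniteMeasure μ]
    (hμ : μ ≠ 0) {q : ℝ} (hq : 1 < q) :
    lowerDim (projMeasure T μ ω) q ≤ ((min (dqLower T μ q) (N : ℝ≥0∞) : ℝ≥0∞) : EReal) := by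
  by_contra! hlt
  obtain ⟨p, hp_min, hp_dim⟩ := EReal.lt_iff_exists_real_btwn.1 hlt
  have hp : 0 ≤ p := by exact_mod_cast (EReal.coe_ennreal_nonneg _).trans hp_min.le
  lift p to ℝ≥0 using hp
  have hpN : (p : ℝ) ≤ N := by
    exact_mod_cast hp_dim.le.trans (lowerDim_projMeasure_le_dim hT hω μ hμ hq)
  have hpd : (p : ℝ≥0∞) ≤ dqLower T μ q := le_iSup₂
    (f := fun (s : ℝ≥0) (_ : momentSeries T μ q s < ∞) => (s : ℝ≥0∞)) p
    (momentSeries_lt_top hN hTinj hT hω μ hq hpN hp_dim)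
  refine hp_min.not_ge (EReal.coe_ennreal_le_coe_ennreal_iff.2 (le_min hpd ?_))
  exact_mod_cast hpN

end UpperBound

/-! ### The generic formula -/

section GenericFormula

variable {m N : ℕ} {Ω : Type*} [MeasurableSpace Ω] {P : Measure Ω} {ω : List (Fin m) → Ω → Esp N}
  {R : ℝ}

theorem ae_min_le_lowerDim [IsProbabilityMeasure P] (hN : 0 < N) {T : Fin m → Esp N →L[ℝ] Esp N}
    (hTinj : ∀ i, Function.Injective (T i)) (hT : ∀ i, ‖T i‖ < 1) (μ : Measure (CodeSpace m))
    [IsFiniteMeasure μ] (h : IsBoundedIID P ω R) {q : ℝ} (hq : 1 < q) :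
    ∀ᵐ x ∂P, ((min (dqLower T μ q) (N : ℝ≥0∞) : ℝ≥0∞) : EReal) ≤
      lowerDim (projMeasure T μ fun w => ω w x) q := by
  have hrat : ∀ᵐ x ∂P, ∀ p : ℚ, ((p : ℝ).toNNReal : ℝ≥0∞) < min (dqLower T μ q) N →
      (((p : ℝ).toNNReal : ℝ) : EReal) ≤ lowerDim (projMeasure T μ fun w => ω w x) q :=
    ae_all_iff.2 fun p => eventually_imp_distrib_left.2 (ae_le_lowerDim hN h hTinj hT μ hq)
  filter_upwards [hrat] with x hx
  by_contra! hlt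
  obtain ⟨p, hp_dim, hp_min⟩ := EReal.lt_iff_exists_rat_btwn.1 hlt
  have : IsFiniteMeasure (projMeasure T μ fun w => ω w x) := by unfold projMeasure; infer_instance
  have hp : (0 : ℝ) ≤ p := by exact_mod_cast (lowerDim_nonneg _ hq).trans hp_dim.le
  have hp_coe : (((p : ℝ).toNNReal : ℝ) : EReal) = ((p : ℝ) : EReal) := by
    rw [Real.coe_toNNReal _ hp]
  refine hp_dim.not_ge (hp_coe.symm.trans_le (hx p ?_))
  exact EReal.coe_ennreal_lt_coe_ennreal_iff.1 (hp_coe.trans_lt hp_min)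

theorem ae_lowerDim_eq_min [IsProbabilityMeasure P] (hN : 0 < N) {T : Fin m → Esp N →L[ℝ] Esp N}
    (hTinj : ∀ i, Function.Injective (T i)) (hT : ∀ i, ‖T i‖ < 1) (μ : Measure (CodeSpace m))
    [IsFiniteMeasure μ] (hμ : μ ≠ 0) (h : IsBoundedIID P ω R) {q : ℝ} (hq : 1 < q) :
    ∀ᵐ x ∂P, lowerDim (projMeasure T μ fun w => ω w x) q =
      ((min (dqLower T μ q) (N : ℝ≥0∞) : ℝ≥0∞) : EReal) := by
  filter_upwards [ae_min_le_lowerDim hN hTinj hT μ h hq] with x hx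
  exact (lowerDim_le_min hN hTinj hT (fun w => h.bound w x) μ hμ hq).antisymm hx

theorem isBoundedIID_indicator (hmeas : ∀ w, Measurable (ω w)) (hindep : iIndepFun ω P)
    (hident : ∀ v w, IdentDistrib (ω v) (ω w) P P) (hac : ∀ w, P.map (ω w) ≪ volume)
    (hR : 0 ≤ R) (hbound : ∀ w, ∀ᵐ x ∂P, ‖ω w x‖ ≤ R) :
    IsBoundedIID P (fun w x => (Metric.closedBall (0 : Esp N) R).indicator id (ω w x)) R := by
  have hf : Measurable ((Metric.closedBall (0 : Esp N) R).indicator id) :=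
    measurable_id.indicator Metric.isClosed_closedBall.measurableSet
  refine ⟨fun w => hf.comp (hmeas w), hindep.comp (fun _ => _) (fun _ => hf),
    fun v w => (hident v w).comp hf, fun w => ?_, fun w x => ?_⟩
  · rw [Measure.map_congr (g := ω w)]
    · exact hac w
    · filter_upwards [hbound w] with x hx
      exact Set.indicator_of_mem (mem_closedBall_zero_iff.2 hx) _
  · by_cases hx : ω w x ∈ Metric.closedBall (0 : Esp N) R
    · rw [Set.indicator_of_mem hx]
      exact mem_closedBall_zero_iff.1 hx
    · rw [Set.indicator_of_notMem hx]
      simpa using hR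

end GenericFormula

end AlmostSelfAffine

end

theorem theorem8p1 {m N : ℕ} (hN : 0 < N)
    (T : Fin m → AlmostSelfAffine.Esp N →L[ℝ] AlmostSelfAffine.Esp N)
    (hT_inj : ∀ i, Function.Injective (T i)) (hT_norm : ∀ i, ‖T i‖ < 1)
    (μ : Measure (AlmostSelfAffine.CodeSpace m)) [IsFiniteMeasure μ] (hμ : μ ≠ 0)
    {Ω : Type*} [MeasurableSpace Ω] (P : Measure Ω) [IsProbabilityMeasure P]
    (ω : List (Fin m) → Ω → AlmostSelfAffine.Esp N)
    (hω_meas : ∀ w, Measurable (ω w))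
    (hω_indep : iIndepFun ω P)
    (hω_ident : ∀ v w, IdentDistrib (ω v) (ω w) P P)
    (hω_ac : ∀ w, P.map (ω w) ≪ volume)
    (D : Set (AlmostSelfAffine.Esp N)) (hD : Bornology.IsBounded D)
    (hω_mem : ∀ w, ∀ᵐ x ∂P, ω w x ∈ D)
    (q : ℝ) (hq : 1 < q) :
    ∀ᵐ x ∂P,
      AlmostSelfAffine.lowerDim (AlmostSelfAffine.projMeasure T μ fun w => ω w x) q =
        ((min (AlmostSelfAffine.dqLower T μ q) (N : ℝ≥0∞) : ℝ≥0∞) : EReal) := by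
  obtain ⟨R, hR, hDR⟩ := hD.exists_pos_norm_le
  have hbound : ∀ w, ∀ᵐ x ∂P, ‖ω w x‖ ≤ R := fun w => (hω_mem w).mono fun x hx => hDR _ hx
  have h := AlmostSelfAffine.isBoundedIID_indicator hω_meas hω_indep hω_ident hω_ac hR.le hbound
  filter_upwards [AlmostSelfAffine.ae_lowerDim_eq_min hN hT_inj hT_norm μ hμ h hq,
    ae_all_iff.2 hbound] with x hx hx'
  have heq : (fun w => (Metric.closedBall (0 : AlmostSelfAffine.Esp N) R).indicator id (ω w x)) =
      fun w => ω w x :=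
    funext fun w => Set.indicator_of_mem (mem_closedBall_zero_iff.2 (hx' w)) _
  rwa [heq] at hx
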